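/- **Setting.** Let $D\subset\mathbb R^3$ be a bounded domain containing the origin, and let $V,f,\sigma\in L^\infty(\mathbb R^3;\mathbb R)$ be supported in $D$. Let $(\Omega,\mathcal F,\mathbb P)$ be a probability space carrying a Gaussian white noise $\dot B$ on $D$: a family of real random variables $\langle\dot B,\varphi\rangle$, $\varphi\in L^2(D)$, with $\langle\dot B,\varphi\rangle\sim\mathcal N(0,\|\varphi\|_{L^2(D)}^2)$ and $\mathbb E(\langle\dot B,\varphi\rangle\langle\dot B,\psi\rangle)=\int_D\varphi\psi\,dx$; the pairing is extended complex-linearly to complex-valued functions. Put $\langle x\rangle=(1+|x|^2)^{1/2}$, $\|u\|_{L^2_s}=\|\langle\cdot\rangle^s u\|_{L^2(\mathbb R^3)}$ and $L^2_s=\{u\in L^1_{loc}(\mathbb R^3;\mathbb C):\|u\|_{L^2_s}<\infty\}$. For $k>0$ let $$\Phi_k(x,y)=\frac{e^{ik|x-y|}}{4\pi|x-y|},\qquad \mathcal R_k\varphi(x)=\int_{\mathbb R^3}\Phi_k(x,y)\varphi(y)\,dy,$$ and let $\mathcal R_k(\sigma\dot B)(x,\omega)=\langle\dot B(\cdot,\omega),\sigma\,\Phi_k(x,\cdot)\rangle$,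 understood as a jointly measurable version in $(x,\omega)$. Let $\alpha\in\{0,1\}$, $d\in\mathbb S^2$ and $u^i(x)=e^{ikx\cdot d}$. For $\epsilon>0$ and $k_0\ge 2$ (for instance the threshold in Agmon's estimate for $\mathcal R_k$ from $L^2_{1/2+\epsilon}$ to $L^2_{-1/2-\epsilon}$) put $$k^*=\max\Big\{k_0,\ \sup\{k>0:\ \|\mathcal R_kV\|_{\mathcal L(L^2_{-1/2-\epsilon})}\ge 1\}+1\Big\},$$ where the supremum of the empty set is $0$. **Theorem.** Let $\epsilon>0$. The supremum above is finite, so $k^*<\infty$. For every $k>k^*$ the field $\mathcal R_k(\sigma\dot B)$ has a jointly measurable version, and for each such version there is a jointly measurable process $u^{sc}:\mathbb R^3\times\Omega\to\mathbb C$ such that, almost surely, $u^{sc}(\cdot,\omega)\in L^2_{-1/2-\epsilon}$ and $$(I-\mathcal R_kV)u^{sc}=\alpha\mathcal R_kVu^i-\mathcal R_kf-\mathcal R_k(\sigma\dot B)\qquad\text{a.e. in }\mathbb R^3 .$$ Almost surely, $u^{sc}(\cdot,\omega)$ is the only solution of this equation in $L^2_{-1/2-\epsilon}$, up to equality almost everywhere.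 Moreover, for every $\epsilon'>0$, $u^{sc}(\cdot,\omega)\in L^2_{-1/2-\epsilon'}$ almost surely. There is a constant $C$ depending only on $\epsilon$, $D$, $V$ such that, for every $k>k^*$, almost surely, $$\|u^{sc}(\cdot,\omega)\|_{L^2_{-1/2-\epsilon}}\le C\big(\|\alpha Vu^i\|_{L^2_{1/2+\epsilon}}+\|f\|_{L^2_{1/2+\epsilon}}+\|\mathcal R_k(\sigma\dot B)\|_{L^2_{-1/2-\epsilon}}\big).$$ Finally, $u=u^{sc}+\alpha u^i$ is the mild solution: up to equality for almost every $\omega$ and almost every $x$, it is the unique jointly measurable process $u$ with $u-\alpha u^i\in L^2_{-1/2-\epsilon}$ and $$(I-\mathcal R_kV)u=\alpha u^i-\mathcal R_kf-\mathcal R_k(\sigma\dot B)\quad\text{a.e. in }\mathbb R^3,\qquad\text{almost surely.}$$ -/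

import Mathlib

open MeasureTheory ProbabilityTheory
open scoped ENNReal NNReal

namespace RandomSchrodinger

noncomputable section

/-- Euclidean three-space. -/
abbrev Space : Type := EuclideanSpace ℝ (Fin 3)

/-- The Japanese bracket `⟨x⟩ = (1 + |x|²)^{1/2}`. -/
def bracket (x : Space) : ℝ := (1 + ‖x‖ ^ 2) ^ (1 / 2 : ℝ)

/-- The weighted norm `‖u‖_{L²_s} = ‖⟨·⟩^s u‖_{L²(ℝ³)}`, with values in `[0, ∞]`. -/
def weightedNorm (s : ℝ) (u : Space → ℂ) : ℝ≥0∞ :=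
  eLpNorm (fun x => ((bracket x ^ s : ℝ) : ℂ) * u x) 2 volume

/-- Membership in the weighted space `L²_s(ℝ³)`. -/
def MemWeightedL2 (s : ℝ) (u : Space → ℂ) : Prop :=
  LocallyIntegrable u volume ∧ weightedNorm s u < ∞

/-- The outgoing fundamental solution `Φ_k(x, y) = e^{ik|x-y|} / (4π|x-y|)` of `-Δ - k²`. -/
def fundamentalSolution (k : ℝ) (x y : Space) : ℂ :=
  Complex.exp (Complex.I * ((k * ‖x - y‖ : ℝ) : ℂ)) / ((4 * Real.pi * ‖x - y‖ : ℝ) : ℂ)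

/-- The resolvent operator `(R_k φ)(x) = ∫ Φ_k(x, y) φ(y) dy`
(the integral over the support of `φ` is the integral over the whole space). -/
def resolvent (k : ℝ) (φ : Space → ℂ) (x : Space) : ℂ :=
  ∫ y, fundamentalSolution k x y * φ y

/-- The incident plane wave `u^i(x) = e^{ik x·d}`. -/
def planeWave (k : ℝ) (d x : Space) : ℂ :=
  Complex.exp (Complex.I * ((k * inner ℝ x d : ℝ) : ℂ))

/-- Multiplication of a complex function by a real one. -/
def realMul (V : Space → ℝ) (u : Space → ℂ) (x : Space) : ℂ := (V x : ℂ) * u x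

/-- The norm of the operator `R_k ∘ V` on `L²_{-1/2-ε}`, with values in `[0, ∞]`. -/
def resolventPotentialNorm (ε k : ℝ) (V : Space → ℝ) : ℝ≥0∞ :=
  sInf {c : ℝ≥0∞ | ∀ u : Space → ℂ, MemWeightedL2 (-(1 / 2) - ε) u →
    weightedNorm (-(1 / 2) - ε) (resolvent k (realMul V u)) ≤ c * weightedNorm (-(1 / 2) - ε) u}

/-- The wave numbers `k > 0` with `‖R_k V‖ ≥ 1` on `L²_{-1/2-ε}`. -/
def badWaveNumbers (ε : ℝ) (V : Space → ℝ) : Set ℝ :=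
  {k : ℝ | 0 < k ∧ 1 ≤ resolventPotentialNorm ε k V}

/-- `k* = max (k₀, sup {k > 0 : ‖R_k V‖ ≥ 1} + 1)`; here the supremum of the empty set is `0`. -/
def kStar (k₀ ε : ℝ) (V : Space → ℝ) : ℝ := max k₀ (sSup (badWaveNumbers ε V) + 1)

/-- Gaussian white noise on `D`: the family of pairings `B φ = ⟨Ḃ, φ⟩`, `φ ∈ L²(D)`, of random
variables with law `N(0, ‖φ‖²_{L²(D)})` and covariance `E(⟨Ḃ, φ⟩⟨Ḃ, ψ⟩) = ∫_D φ ψ`.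
(The values `B φ` for `φ ∉ L²(D)` play no role. The covariance makes `φ ↦ B φ` linear and
independent of the representative of `φ`, up to null sets, so that the family is jointly
Gaussian.) -/
structure IsWhiteNoise {Ω : Type*} [MeasurableSpace Ω] (P : Measure Ω) (D : Set Space)
    (B : (Space → ℝ) → Ω → ℝ) : Prop where
  gaussian : ∀ φ : Space → ℝ, MemLp φ 2 (volume.restrict D) →
    HasLaw (B φ) (gaussianReal 0 (∫ x in D, φ x ^ 2).toNNReal) P
  covariance : ∀ φ ψ : Space → ℝ, MemLp φ 2 (volume.restrict D) →
    MemLp ψ 2 (volume.restrict D) → ∫ ω, B φ ω * B ψ ω ∂P = ∫ x in D, φ x * ψ x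

/-- The random variable `⟨Ḃ, σ Φ_k(x, ·)⟩`, the pairing being extended to complex-valued functions
by complex linearity. -/
def noisePairing {Ω : Type*} (B : (Space → ℝ) → Ω → ℝ) (k : ℝ) (σ : Space → ℝ) (x : Space)
    (ω : Ω) : ℂ :=
  (B (fun y => σ y * (fundamentalSolution k x y).re) ω : ℂ) +
    Complex.I * (B (fun y => σ y * (fundamentalSolution k x y).im) ω : ℂ)

/-- `Y ω x` is the random field `R_k(σ Ḃ_x)(ω) = ⟨Ḃ(·, ω), σ Φ_k(x, ·)⟩`. For each `x` the right-hand
side is determined up to a null set only; as usual, `Y` is a jointly measurable version. -/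
structure IsNoisePotential {Ω : Type*} [MeasurableSpace Ω] (P : Measure Ω)
    (B : (Space → ℝ) → Ω → ℝ) (k : ℝ) (σ : Space → ℝ) (Y : Ω → Space → ℂ) : Prop where
  measurable : Measurable (Function.uncurry Y)
  version : ∀ x : Space, ∀ᵐ ω ∂P, Y ω x = noisePairing B k σ x ω

/-- The Lippmann–Schwinger equation for the scattered field (equality of functions a.e.), with `y`
a realization of `R_k(σ Ḃ)`:
`(I - R_k V) u = α R_k V u^i - R_k f - y`. -/
def SolvesScattered (k α : ℝ) (d : Space) (V f : Space → ℝ) (y u : Space → ℂ) : Prop :=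
  ∀ᵐ x : Space, u x - resolvent k (realMul V u) x =
    (α : ℂ) * resolvent k (realMul V (planeWave k d)) x
      - resolvent k (fun z => (f z : ℂ)) x - y x

/-- The Lippmann–Schwinger equation for the total field (equality of functions a.e.), with `y`
a realization of `R_k(σ Ḃ)`:
`(I - R_k V) u = α u^i - R_k f - y`. -/
def SolvesTotal (k α : ℝ) (d : Space) (V f : Space → ℝ) (y u : Space → ℂ) : Prop :=
  ∀ᵐ x : Space, u x - resolvent k (realMul V u) x =
    (α : ℂ) * planeWave k d x - resolvent k (fun z => (f z : ℂ)) x - y x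

/-- The process `u` is a scattered field: almost surely, `u(·, ω)` lies in `L²_{-1/2-ε}` and solves
the Lippmann–Schwinger equation for the scattered field. -/
structure IsScatteredField {Ω : Type*} [MeasurableSpace Ω] (P : Measure Ω) (ε k α : ℝ) (d : Space)
    (V f : Space → ℝ) (Y u : Ω → Space → ℂ) : Prop where
  measurable : Measurable (Function.uncurry u)
  mem : ∀ᵐ ω ∂P, MemWeightedL2 (-(1 / 2) - ε) (u ω)
  solves : ∀ᵐ ω ∂P, SolvesScattered k α d V f (Y ω) (u ω)

/-- The process `u` is a mild solution of the random scattering system: almost surely,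
`u(·, ω) - α u^i` lies in `L²_{-1/2-ε}` and `u(·, ω)` solves the Lippmann–Schwinger equation for the
total field. -/
structure IsMildSolution {Ω : Type*} [MeasurableSpace Ω] (P : Measure Ω) (ε k α : ℝ) (d : Space)
    (V f : Space → ℝ) (Y u : Ω → Space → ℂ) : Prop where
  measurable : Measurable (Function.uncurry u)
  mem : ∀ᵐ ω ∂P, MemWeightedL2 (-(1 / 2) - ε) (fun x => u ω x - (α : ℂ) * planeWave k d x)
  solves : ∀ᵐ ω ∂P, SolvesTotal k α d V f (Y ω) (u ω)

end

end RandomSchrodinger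

open RandomSchrodinger

namespace RandomSchrodinger

noncomputable section

/-! Once `R_k V` is a contraction on `L²_{-1/2-ε}`, the equation `(I - R_k V) u = g` is solved
realization by realization by a Neumann series. Three things need proof: contraction with one
constant `c < 1` for all admissible `k`, so that the constant `C` does not depend on `k`; membership
of the noise potential in the weighted space; joint measurability of the solution.

Contraction. Since `V` lives on the bounded set `D`, only `R_k : L²(D) → L²_{-1/2-ε}` matters. Its
kernel has modulus `1 / (4π|x - y|)`, so it is Hilbert–Schmidt with a norm that is finite but
independent of `k`, hence without decay. The decay is found in `R_k* R_k`, whose kernel at `(y, y')`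
is an oscillatory integral with phase `k(|x - y'| - |x - y|)`. For `y ≠ y'` this phase pulls null
sets back to null sets (`volume_phase_preimage_eq_zero`), so the Riemann–Lebesgue lemma sends the
kernel to zero pointwise, and dominated convergence sends its Hilbert–Schmidt norm to zero. As `‖R_k
φ‖⁴ ≤ ‖R_k* R_k‖²_HS ‖φ‖⁴`, the operator norm of `R_k` tends to zero
(`eventually_weightedNorm_resolvent_le`). This bounds the bad wave numbers. On the remaining compact
range of `k`, continuity of `k ↦ R_k` in Hilbert–Schmidt norm and compactness give a uniform
constant (`exists_uniform_resolventPotentialBound`).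

Noise. The covariance identity yields the isometry `E|B φ - B ψ|² = ‖φ - ψ‖²`. It gives a jointly
measurable version, by approximation from a countable dense family, and by Tonelli it bounds the
expected squared weighted norm of `R_k(σ Ḃ)` by a Hilbert–Schmidt integral. This holds for every `ε'
> 0`, and the equation passes it on to the solution.

Measurability. The solution is the pointwise sum of the Neumann series rather than an `L²` limit;
each term is jointly measurable, hence so is the sum. -/

theorem eLpNorm_two_sq {X E : Type*} [MeasurableSpace X] [NormedAddCommGroup E] (μ : Measure X)
    (u : X → E) : eLpNorm u 2 μ ^ 2 = ∫⁻ x, ‖u x‖ₑ ^ 2 ∂μ := by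
  rw [eLpNorm_eq_lintegral_rpow_enorm_toReal (by norm_num) (by norm_num), ← ENNReal.rpow_natCast,
    ← ENNReal.rpow_mul]
  simp

/-! ### The bracket, and `L²_s` as the `L²` space of a measure. -/

theorem bracket_pos (x : Space) : 0 < bracket x := by unfold bracket; positivity

theorem one_le_bracket (x : Space) : 1 ≤ bracket x := by
  unfold bracket
  exact Real.one_le_rpow (by nlinarith [norm_nonneg x]) (by norm_num)

theorem bracket_sq (x : Space) : bracket x ^ 2 = 1 + ‖x‖ ^ 2 := by
  unfold bracket
  rw [← Real.rpow_natCast, ← Real.rpow_mul (by positivity)]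
  norm_num

theorem continuous_bracket : Continuous bracket := by
  unfold bracket
  refine Continuous.rpow_const (by fun_prop) fun x => Or.inr (by norm_num)

theorem continuous_bracket_rpow (s : ℝ) : Continuous fun x => bracket x ^ s :=
  continuous_bracket.rpow_const fun x => Or.inl (bracket_pos x).ne'

/-- The measure `⟨x⟩^{2s} dx`, whose `L²` space is `L²_s`. -/
def weightedMeasure (s : ℝ) : Measure Space :=
  volume.withDensity fun x => ENNReal.ofReal (bracket x ^ (2 * s))

theorem measurable_weight (s : ℝ) :
    Measurable fun x : Space => ENNReal.ofReal (bracket x ^ s) :=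
  (continuous_bracket_rpow s).measurable.ennreal_ofReal

theorem lintegral_weightedMeasure (s : ℝ) (g : Space → ℝ≥0∞) :
    ∫⁻ x, g x ∂weightedMeasure s = ∫⁻ x, ENNReal.ofReal (bracket x ^ (2 * s)) * g x := by
  unfold weightedMeasure
  rw [lintegral_withDensity_eq_lintegral_mul_non_measurable _ (measurable_weight _)
    (Filter.Eventually.of_forall fun x => ENNReal.ofReal_lt_top)]
  rfl

instance (s : ℝ) : SigmaFinite (weightedMeasure s) :=
  SigmaFinite.withDensity_ofReal _

theorem weightedMeasure_absolutelyContinuous (s : ℝ) : weightedMeasure s ≪ volume :=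
  withDensity_absolutelyContinuous _ _

theorem absolutelyContinuous_weightedMeasure (s : ℝ) : (volume : Measure Space) ≪ weightedMeasure s :=
  withDensity_absolutelyContinuous' (measurable_weight _).aemeasurable
    (Filter.Eventually.of_forall fun x => by
      have := Real.rpow_pos_of_pos (bracket_pos x) (2 * s)
      simpa using this)

theorem ae_weightedMeasure_iff (s : ℝ) {p : Space → Prop} :
    (∀ᵐ x ∂weightedMeasure s, p x) ↔ ∀ᵐ x, p x :=
  ⟨fun h => (absolutelyContinuous_weightedMeasure s).ae_le h,
    fun h => (weightedMeasure_absolutelyContinuous s).ae_le h⟩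

theorem enorm_weight_mul_sq (s : ℝ) (x : Space) (z : ℂ) :
    ‖((bracket x ^ s : ℝ) : ℂ) * z‖ₑ ^ 2 = ENNReal.ofReal (bracket x ^ (2 * s)) * ‖z‖ₑ ^ 2 := by
  have h : 0 ≤ bracket x ^ s := Real.rpow_nonneg (bracket_pos x).le _
  rw [enorm_mul, mul_pow]
  congr 1
  rw [← ofReal_norm, Complex.norm_real, Real.norm_of_nonneg h, ← ENNReal.ofReal_pow h,
    mul_comm 2 s, Real.rpow_mul (bracket_pos x).le]
  norm_num

theorem weightedNorm_eq (s : ℝ) (u : Space → ℂ) :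
    weightedNorm s u = eLpNorm u 2 (weightedMeasure s) := by
  have h : weightedNorm s u ^ 2 = eLpNorm u 2 (weightedMeasure s) ^ 2 := by
    rw [weightedNorm, eLpNorm_two_sq, eLpNorm_two_sq, lintegral_weightedMeasure]
    exact lintegral_congr fun x => enorm_weight_mul_sq s x _
  exact (ENNReal.pow_right_strictMono two_ne_zero).injective h

/-- Local integrability comes for free from the finite norm: `⟨x⟩^s u` is in `L²`, hence locally
integrable, and multiplying by the continuous function `⟨x⟩^{-s}` preserves this. -/
theorem memWeightedL2_iff (s : ℝ) (u : Space → ℂ) :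
    MemWeightedL2 s u ↔ MemLp u 2 (weightedMeasure s) := by
  unfold MemWeightedL2 MemLp
  rw [weightedNorm_eq]
  constructor
  · rintro ⟨h1, h2⟩
    exact ⟨h1.aestronglyMeasurable.mono_ac (weightedMeasure_absolutelyContinuous s), h2⟩
  · rintro ⟨h1, h2⟩
    refine ⟨?_, h2⟩
    have h3 : AEStronglyMeasurable u volume := h1.mono_ac (absolutelyContinuous_weightedMeasure s)
    have h4 : MemLp (fun x => ((bracket x ^ s : ℝ) : ℂ) * u x) 2 volume := by
      refine ⟨?_, ?_⟩
      · exact (Complex.continuous_ofReal.comp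
          (continuous_bracket_rpow s)).aestronglyMeasurable.mul h3
      · change weightedNorm s u < ∞
        rwa [weightedNorm_eq]
    have h5 := (h4.locallyIntegrable (by norm_num)).smul_continuous (𝕜 := ℂ)
      (g := fun x => ((bracket x ^ (-s) : ℝ) : ℂ))
      (Complex.continuous_ofReal.comp (continuous_bracket_rpow (-s)))
    refine h5.congr (Filter.Eventually.of_forall fun x => ?_)
    have h6 : bracket x ^ s ≠ 0 := (Real.rpow_pos_of_pos (bracket_pos x) s).ne'
    have h7 : ((bracket x ^ s : ℝ) : ℂ) ≠ 0 := by exact_mod_cast h6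
    simp only [smul_eq_mul]
    rw [Real.rpow_neg (bracket_pos x).le, Complex.ofReal_inv]
    field_simp

/-! ### The kernel of the resolvent -/

theorem norm_fundamentalSolution (k : ℝ) (x y : Space) :
    ‖fundamentalSolution k x y‖ = (4 * Real.pi * ‖x - y‖)⁻¹ := by
  unfold fundamentalSolution
  rw [norm_div, mul_comm Complex.I, Complex.norm_exp_ofReal_mul_I, Complex.norm_real,
    Real.norm_of_nonneg (by positivity), one_div]

theorem enorm_fundamentalSolution (k : ℝ) (x y : Space) :
    ‖fundamentalSolution k x y‖ₑ = ENNReal.ofReal (4 * Real.pi * ‖x - y‖)⁻¹ := by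
  rw [← ofReal_norm, norm_fundamentalSolution]

/-- The wave number enters only through a phase; this makes all size estimates uniform in it. -/
theorem enorm_fundamentalSolution_eq (k l : ℝ) (x y : Space) :
    ‖fundamentalSolution k x y‖ₑ = ‖fundamentalSolution l x y‖ₑ := by
  rw [enorm_fundamentalSolution, enorm_fundamentalSolution]

theorem enorm_fundamentalSolution_comm (k : ℝ) (x y : Space) :
    ‖fundamentalSolution k x y‖ₑ = ‖fundamentalSolution k y x‖ₑ := by
  rw [enorm_fundamentalSolution, enorm_fundamentalSolution, norm_sub_rev]

@[fun_prop]
theorem measurable_fundamentalSolution {X : Type*} [MeasurableSpace X] (k : ℝ) {f g : X → Space}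
    (hf : Measurable f) (hg : Measurable g) :
    Measurable fun a => fundamentalSolution k (f a) (g a) := by
  unfold fundamentalSolution
  fun_prop

theorem measurable_fundamentalSolution_uncurry (k : ℝ) :
    Measurable fun p : Space × Space => fundamentalSolution k p.1 p.2 := by
  fun_prop

@[fun_prop]
theorem measurable_conj : Measurable (starRingEnd ℂ) := Complex.continuous_conj.measurable

theorem bracket_sub_le (x y : Space) : bracket (x - y) ^ 2 ≤ 2 * bracket x ^ 2 * bracket y ^ 2 := by
  rw [bracket_sq, bracket_sq, bracket_sq]
  have := norm_sub_le x y
  nlinarith [norm_nonneg (x - y), sq_nonneg (‖x‖ - ‖y‖), sq_nonneg (‖x‖ * ‖y‖), norm_nonneg x,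
    norm_nonneg y]

/-- Peetre's inequality: decay in `x` is traded for decay in `x - y`, at the cost of a power of
`⟨y⟩`. It moves the pole of the kernel to the origin. -/
theorem bracket_rpow_neg_le {t : ℝ} (ht : 0 ≤ t) (x y : Space) :
    bracket x ^ (-t) ≤ 2 ^ (t / 2) * bracket y ^ t * bracket (x - y) ^ (-t) := by
  have hx := bracket_pos x
  have hy := bracket_pos y
  have hz := bracket_pos (x - y)
  have h := Real.rpow_le_rpow (by positivity) (bracket_sub_le x y) (show 0 ≤ t / 2 by positivity)
  have e : ∀ b : ℝ, 0 < b → (b ^ 2) ^ (t / 2) = b ^ t := fun b hb => by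
    rw [← Real.rpow_natCast, ← Real.rpow_mul hb.le]; congr 1; push_cast; ring
  rw [e _ hz, Real.mul_rpow (by positivity) (by positivity), Real.mul_rpow (by positivity)
    (by positivity), e _ hx, e _ hy] at h
  rw [Real.rpow_neg hx.le, Real.rpow_neg hz.le, ← div_eq_mul_inv, le_div_iff₀ (by positivity),
    inv_mul_le_iff₀ (by positivity)]
  linarith

/-- In polar coordinates the Jacobian `r²` of three-space cancels the singularity, leaving `(1 +
r²)^{-t/2}` on the half-line. -/
theorem integrable_bracket_rpow_mul_inv_sq {t : ℝ} (ht : 1 < t) :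
    Integrable (fun z : Space => bracket z ^ (-t) * (‖z‖ ^ 2)⁻¹) := by
  have h := integrable_fun_norm_addHaar (volume : Measure Space)
    (f := fun r : ℝ => ((1 + r ^ 2) ^ (1 / 2 : ℝ)) ^ (-t) * (r ^ 2)⁻¹)
  refine h.2 ?_
  have h1 := (integrable_rpow_neg_one_add_norm_sq (E := ℝ) (μ := volume) (r := t)
    (by simpa using ht)).integrableOn (s := Set.Ioi 0)
  refine h1.congr_fun (fun r hr => ?_) measurableSet_Ioi
  have hr' : (0 : ℝ) < r := hr
  simp only [finrank_euclideanSpace, Fintype.card_fin, smul_eq_mul, Real.norm_eq_abs, sq_abs]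
  rw [← Real.rpow_mul (by positivity)]
  have : (1 / 2 * -t : ℝ) = -t / 2 := by ring
  rw [this]
  norm_num
  field_simp

/-- The weighted `L²` norm of the fundamental solution with pole `y` is finite and grows at most
like a power of `⟨y⟩`. -/
theorem exists_lintegral_fundamentalSolution_le {ε : ℝ} (hε : 0 < ε) :
    ∃ C : ℝ≥0, ∀ (k : ℝ) (y : Space),
      ∫⁻ x, ‖fundamentalSolution k x y‖ₑ ^ 2 ∂weightedMeasure (-(1 / 2) - ε) ≤
        C * ENNReal.ofReal (bracket y ^ (1 + 2 * ε)) := by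
  -- The density of the weighted measure is `⟨x⟩^{-t}`; the requirement `1 < t` is exactly `0 < ε`.
  set t : ℝ := 1 + 2 * ε with ht
  have hint := integrable_bracket_rpow_mul_inv_sq (t := t) (by linarith)
  set I : ℝ≥0∞ := ∫⁻ z : Space, ENNReal.ofReal (bracket z ^ (-t) * (‖z‖ ^ 2)⁻¹) with hI
  have hIfin : I < ∞ := by
    have := hint.hasFiniteIntegral
    rw [hasFiniteIntegral_iff_ofReal (Filter.Eventually.of_forall fun z => by
      have := bracket_pos z
      positivity)] at this
    exact this
  refine ⟨(ENNReal.ofReal (2 ^ (t / 2)) * I).toNNReal, fun k y => ?_⟩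
  rw [ENNReal.coe_toNNReal (ENNReal.mul_lt_top ENNReal.ofReal_lt_top hIfin).ne,
    lintegral_weightedMeasure]
  calc ∫⁻ x, ENNReal.ofReal (bracket x ^ (2 * (-(1 / 2) - ε))) * ‖fundamentalSolution k x y‖ₑ ^ 2
      ≤ ∫⁻ x, ENNReal.ofReal (2 ^ (t / 2) * bracket y ^ t) *
          ENNReal.ofReal (bracket (x - y) ^ (-t) * (‖x - y‖ ^ 2)⁻¹) := by
        refine lintegral_mono fun x => ?_
        rw [enorm_fundamentalSolution, ← ENNReal.ofReal_pow (by positivity),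
          ← ENNReal.ofReal_mul (Real.rpow_nonneg (bracket_pos x).le _),
          ← ENNReal.ofReal_mul (by have := bracket_pos y; positivity)]
        refine ENNReal.ofReal_le_ofReal ?_
        have e : 2 * (-(1 / 2) - ε) = -t := by rw [ht]; ring
        rw [e, ← mul_assoc]
        have h1 := bracket_rpow_neg_le (t := t) (by linarith) x y
        have h2 : ((4 * Real.pi * ‖x - y‖)⁻¹) ^ 2 ≤ (‖x - y‖ ^ 2)⁻¹ := by
          rw [inv_pow, mul_pow, mul_inv]
          refine mul_le_of_le_one_left (by positivity) ?_
          refine inv_le_one_of_one_le₀ ?_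
          nlinarith [Real.pi_gt_three]
        have := bracket_pos x
        exact mul_le_mul h1 h2 (by positivity) (by
          have := bracket_pos y
          have := bracket_pos (x - y)
          positivity)
    _ = ENNReal.ofReal (2 ^ (t / 2) * bracket y ^ t) * I := by
        rw [lintegral_const_mul' _ _ ENNReal.ofReal_ne_top, hI]
        congr 1
        exact lintegral_sub_right_eq_self
          (fun z : Space => ENNReal.ofReal (bracket z ^ (-t) * (‖z‖ ^ 2)⁻¹)) y
    _ = _ := by
        rw [ENNReal.ofReal_mul (by positivity)]
        ring

/-! ### Hilbert–Schmidt integral operators -/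

section HilbertSchmidt

variable {X Y : Type*} [MeasurableSpace X] [MeasurableSpace Y] {μ : Measure X} {ν : Measure Y}

theorem lintegral_mul_sq_le {f g : X → ℝ≥0∞} (hf : AEMeasurable f μ) (hg : AEMeasurable g μ) :
    (∫⁻ x, f x * g x ∂μ) ^ 2 ≤ (∫⁻ x, f x ^ 2 ∂μ) * ∫⁻ x, g x ^ 2 ∂μ := by
  have h := ENNReal.lintegral_mul_le_Lp_mul_Lq μ Real.HolderConjugate.two_two hf hg
  have h2 := pow_le_pow_left₀ zero_le h 2
  rw [mul_pow, ← ENNReal.rpow_natCast (_ ^ (1 / 2 : ℝ)), ← ENNReal.rpow_natCast (_ ^ (1 / 2 : ℝ)),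
    ← ENNReal.rpow_mul, ← ENNReal.rpow_mul] at h2
  simpa using h2

theorem lintegral_enorm_mul_sq_le {f g : X → ℂ} (hf : AEStronglyMeasurable f μ)
    (hg : AEStronglyMeasurable g μ) :
    (∫⁻ x, ‖f x * g x‖ₑ ∂μ) ^ 2 ≤ (∫⁻ x, ‖f x‖ₑ ^ 2 ∂μ) * ∫⁻ x, ‖g x‖ₑ ^ 2 ∂μ := by
  simp_rw [enorm_mul]
  exact lintegral_mul_sq_le hf.enorm hg.enorm

theorem enorm_integral_mul_sq_le {f g : X → ℂ} (hf : AEStronglyMeasurable f μ)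
    (hg : AEStronglyMeasurable g μ) :
    ‖∫ x, f x * g x ∂μ‖ₑ ^ 2 ≤ (∫⁻ x, ‖f x‖ₑ ^ 2 ∂μ) * ∫⁻ x, ‖g x‖ₑ ^ 2 ∂μ :=
  (pow_le_pow_left₀ zero_le (enorm_integral_le_lintegral_enorm _) 2).trans
    (lintegral_enorm_mul_sq_le hf hg)

theorem integrable_mul_of_lintegral_sq_lt_top {f g : X → ℂ} (hf : AEStronglyMeasurable f μ)
    (hg : AEStronglyMeasurable g μ) (hf2 : ∫⁻ x, ‖f x‖ₑ ^ 2 ∂μ < ∞)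
    (hg2 : ∫⁻ x, ‖g x‖ₑ ^ 2 ∂μ < ∞) : Integrable (fun x => f x * g x) μ := by
  refine ⟨hf.mul hg, ?_⟩
  have h := (lintegral_enorm_mul_sq_le hf hg).trans_lt (ENNReal.mul_lt_top hf2 hg2)
  exact (ENNReal.pow_lt_top_iff.1 h).resolve_right two_ne_zero

theorem lintegral_enorm_integral_sq_le [SFinite ν] {K : X → Y → ℂ}
    (hK : Measurable fun p : X × Y => K p.1 p.2) {u : Y → ℂ} (hu : AEStronglyMeasurable u ν) :
    ∫⁻ x, ‖∫ y, K x y * u y ∂ν‖ₑ ^ 2 ∂μ ≤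
      (∫⁻ p, ‖K p.1 p.2‖ₑ ^ 2 ∂μ.prod ν) * ∫⁻ y, ‖u y‖ₑ ^ 2 ∂ν := by
  rw [lintegral_prod _ ((hK.enorm.pow_const 2).aemeasurable), ← lintegral_mul_const]
  · refine lintegral_mono fun x => enorm_integral_mul_sq_le ?_ hu
    exact (hK.comp measurable_prodMk_left).aestronglyMeasurable
  · exact (hK.enorm.pow_const 2).lintegral_prod_right'

/-- The norm of an integral operator `T` is controlled by the Hilbert–Schmidt norm of `T* T`. -/
theorem sq_lintegral_enorm_integral_sq_le [SFinite μ] [SFinite ν] {K : X → Y → ℂ}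
    (hK : Measurable fun p : X × Y => K p.1 p.2) (hK2 : ∫⁻ p, ‖K p.1 p.2‖ₑ ^ 2 ∂μ.prod ν < ∞)
    {u : Y → ℂ} (hu : Measurable u) (hu2 : ∫⁻ y, ‖u y‖ₑ ^ 2 ∂ν < ∞) :
    (∫⁻ x, ‖∫ y, K x y * u y ∂ν‖ₑ ^ 2 ∂μ) ^ 2 ≤
      (∫⁻ q, ‖∫ x, starRingEnd ℂ (K x q.1) * K x q.2 ∂μ‖ₑ ^ 2 ∂ν.prod ν) *
        (∫⁻ y, ‖u y‖ₑ ^ 2 ∂ν) ^ 2 := by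
  have hKu : Measurable fun p : X × Y => K p.1 p.2 * u p.2 := hK.mul (hu.comp measurable_snd)
  have hconj : Measurable (starRingEnd ℂ) := Complex.continuous_conj.measurable
  -- The integrand of `|∫ K(x,y) u(y) dy|²` written as a double integral.
  set F : X → Y × Y → ℂ := fun x q =>
    starRingEnd ℂ (K x q.1 * u q.1) * (K x q.2 * u q.2) with hF
  have hFm : Measurable (Function.uncurry F) := by
    refine (hconj.comp (hKu.comp (measurable_fst.prodMk
      (measurable_fst.comp measurable_snd)))).mul (hKu.comp (measurable_fst.prodMk
      (measurable_snd.comp measurable_snd)))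
  -- For fixed `x` the integral of `|F|` is `(∫ |K(x,y) u(y)| dy)²`, which Cauchy–Schwarz controls
  -- by the Hilbert–Schmidt density times `‖u‖²`.
  have hFint : Integrable (Function.uncurry F) (μ.prod (ν.prod ν)) := by
    refine ⟨hFm.aestronglyMeasurable, ?_⟩
    rw [HasFiniteIntegral, lintegral_prod _ hFm.enorm.aemeasurable]
    refine lt_of_le_of_lt ?_ (ENNReal.mul_lt_top hK2 hu2)
    rw [lintegral_prod _ ((hK.enorm.pow_const 2).aemeasurable), ← lintegral_mul_const]
    · refine lintegral_mono fun x => ?_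
      have hx : Measurable fun y => K x y * u y := hKu.comp measurable_prodMk_left
      have h1 : ∫⁻ q, ‖Function.uncurry F (x, q)‖ₑ ∂ν.prod ν = (∫⁻ y, ‖K x y * u y‖ₑ ∂ν) ^ 2 := by
        have : ∀ q : Y × Y, ‖Function.uncurry F (x, q)‖ₑ =
            ‖K x q.1 * u q.1‖ₑ * ‖K x q.2 * u q.2‖ₑ := fun q => by
          simp only [hF, Function.uncurry_apply_pair]
          rw [enorm_mul, RCLike.enorm_conj]
        simp_rw [this]
        rw [lintegral_prod_mul (f := fun y => ‖K x y * u y‖ₑ) (g := fun y => ‖K x y * u y‖ₑ)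
          hx.enorm.aemeasurable hx.enorm.aemeasurable, sq]
      rw [h1]
      exact lintegral_enorm_mul_sq_le
        (hK.comp measurable_prodMk_left).aestronglyMeasurable hu.aestronglyMeasurable
    · exact (hK.enorm.pow_const 2).lintegral_prod_right'
  have hsq : ∀ x, ∫ q, F x q ∂ν.prod ν = ((‖∫ y, K x y * u y ∂ν‖ ^ 2 : ℝ) : ℂ) := fun x => by
    rw [← Complex.normSq_eq_norm_sq, Complex.normSq_eq_conj_mul_self, ← integral_conj]
    exact integral_prod_mul (fun y => starRingEnd ℂ (K x y * u y)) (fun y => K x y * u y)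
  have hTint : Integrable (fun x => (‖∫ y, K x y * u y ∂ν‖ ^ 2 : ℝ)) μ := by
    have h := hFint.integral_prod_left.norm
    refine h.congr (Filter.Eventually.of_forall fun x => ?_)
    simp only [Function.uncurry_apply_pair]
    rw [hsq x, Complex.norm_real, Real.norm_of_nonneg (by positivity)]
  have hL : ∫⁻ x, ‖∫ y, K x y * u y ∂ν‖ₑ ^ 2 ∂μ = ‖∫ x, ∫ q, F x q ∂ν.prod ν ∂μ‖ₑ := by
    simp_rw [hsq]
    rw [integral_complex_ofReal, ← ofReal_norm, Complex.norm_real,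
      Real.norm_of_nonneg (integral_nonneg fun x => by positivity),
      ofReal_integral_eq_lintegral_ofReal hTint (Filter.Eventually.of_forall fun x => by positivity)]
    refine lintegral_congr fun x => ?_
    rw [ENNReal.ofReal_pow (norm_nonneg _), ofReal_norm]
  have hpull : ∀ q : Y × Y, ∫ x, F x q ∂μ =
      (∫ x, starRingEnd ℂ (K x q.1) * K x q.2 ∂μ) * (starRingEnd ℂ (u q.1) * u q.2) := fun q => by
    rw [← integral_mul_const]
    refine integral_congr_ae (Filter.Eventually.of_forall fun x => ?_)
    simp only [hF, map_mul]
    ring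
  -- After Fubini `‖T u‖²` pairs the kernel of `T* T` with `conj u ⊗ u`; Cauchy–Schwarz on `Y × Y`
  -- finishes.
  rw [hL, integral_integral_swap hFint]
  simp_rw [hpull]
  refine (enorm_integral_mul_sq_le ?_ ?_).trans (le_of_eq ?_)
  · have : Measurable (Function.uncurry fun (q : Y × Y) (x : X) =>
        starRingEnd ℂ (K x q.1) * K x q.2) :=
      (hconj.comp (hK.comp (measurable_snd.prodMk (measurable_fst.comp measurable_fst)))).mul
        (hK.comp (measurable_snd.prodMk (measurable_snd.comp measurable_fst)))
    exact (this.stronglyMeasurable.integral_prod_right).aestronglyMeasurable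
  · exact ((hconj.comp (hu.comp measurable_fst)).mul
      (hu.comp measurable_snd)).aestronglyMeasurable
  · congr 1
    simp_rw [enorm_mul, RCLike.enorm_conj, mul_pow]
    rw [lintegral_prod_mul (f := fun y => ‖u y‖ₑ ^ 2) (g := fun y => ‖u y‖ₑ ^ 2)
      (hu.enorm.pow_const 2).aemeasurable (hu.enorm.pow_const 2).aemeasurable, sq]

end HilbertSchmidt

/-! ### Oscillation of the phase `|x - y| - |x - y'|` -/

/-- By change of variables, the integral of `f'` over the preimage is the measure of a subset of
`N`, hence zero; a positive function with zero integral lives on a null set. -/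
theorem volume_preimage_eq_zero_of_deriv_pos {f f' : ℝ → ℝ} (hf : ∀ t, HasDerivAt f (f' t) t)
    (hpos : ∀ t, 0 < f' t) {N : Set ℝ} (hN : MeasurableSet N) (hN0 : volume N = 0) :
    volume (f ⁻¹' N) = 0 := by
  have hfm : Measurable f :=
    (continuous_iff_continuousAt.2 fun t => (hf t).continuousAt).measurable
  have hmono : StrictMono f := strictMono_of_deriv_pos fun t => by
    rw [(hf t).deriv]
    exact hpos t
  have hs : MeasurableSet (f ⁻¹' N) := hfm hN
  have h := lintegral_image_eq_lintegral_abs_deriv_mul hs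
    (fun x _ => (hf x).hasDerivWithinAt) hmono.injective.injOn fun _ => 1
  have h0 : volume (f '' (f ⁻¹' N)) = 0 := measure_mono_null (Set.image_preimage_subset f N) hN0
  rw [setLIntegral_one, h0] at h
  have hfd : Measurable f' := by
    have : f' = deriv f := funext fun t => (hf t).deriv.symm
    rw [this]
    exact measurable_deriv f
  have h1 := (lintegral_eq_zero_iff (by fun_prop)).1 h.symm
  rw [Filter.EventuallyEq, ae_restrict_iff' hs] at h1
  rw [measure_eq_zero_iff_ae_notMem]
  filter_upwards [h1] with x hx hxs
  have := hx hxs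
  simp only [mul_one, Pi.zero_apply, ENNReal.ofReal_eq_zero, abs_nonpos_iff] at this
  exact (hpos x).ne' this

section Phase

variable {E : Type*} [NormedAddCommGroup E] [InnerProductSpace ℝ E]

/-- Strict convexity of the norm along a line missing the origin. With `q = p + e`, clearing
denominators leaves `(‖p‖ + ‖q‖)(‖p‖‖q‖ - ⟨p, q⟩) > 0`, which is strict Cauchy–Schwarz. -/
theorem inner_div_norm_lt_inner_add_div_norm {p e : E} (he0 : e ≠ 0)
    (hp : p ∉ Submodule.span ℝ {e}) :
    inner ℝ p e / ‖p‖ < inner ℝ (p + e) e / ‖p + e‖ := by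
  have hp0 : p ≠ 0 := fun h => hp (h ▸ Submodule.zero_mem _)
  have hq0 : p + e ≠ 0 := fun h => hp (by
    rw [eq_neg_of_add_eq_zero_left h]
    exact Submodule.neg_mem _ (Submodule.mem_span_singleton_self e))
  have hpn : 0 < ‖p‖ := norm_pos_iff.2 hp0
  have hqn : 0 < ‖p + e‖ := norm_pos_iff.2 hq0
  have hlt : inner ℝ p (p + e) < ‖p‖ * ‖p + e‖ := by
    refine lt_of_le_of_ne (real_inner_le_norm _ _) fun h => hp ?_
    have h2 := inner_eq_norm_mul_iff_real.1 h
    rw [smul_add] at h2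
    have h3 : (‖p + e‖ - ‖p‖) • p = ‖p‖ • e := by
      rw [sub_smul, h2]; abel
    by_cases hc : ‖p + e‖ - ‖p‖ = 0
    · rw [hc, zero_smul] at h3
      have he : e = 0 := (smul_eq_zero.1 h3.symm).resolve_left hpn.ne'
      exact absurd he he0
    · rw [Submodule.mem_span_singleton]
      refine ⟨(‖p + e‖ - ‖p‖)⁻¹ * ‖p‖, ?_⟩
      rw [mul_smul, ← h3, smul_smul, inv_mul_cancel₀ hc, one_smul]
  have e1 : inner ℝ p e = inner ℝ p (p + e) - ‖p‖ ^ 2 := by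
    rw [inner_add_right, real_inner_self_eq_norm_sq]; ring
  have e2 : inner ℝ (p + e) e = ‖p + e‖ ^ 2 - inner ℝ p (p + e) := by
    rw [← real_inner_self_eq_norm_sq, inner_add_right (p + e), real_inner_comm p (p + e)]
    ring
  rw [div_lt_div_iff₀ hpn hqn, e1, e2]
  nlinarith [mul_pos (sub_pos.2 hlt) (add_pos hpn hqn)]

theorem hasDerivAt_norm_add_smul {p e : E} {t : ℝ} (h : p + t • e ≠ 0) :
    HasDerivAt (fun s : ℝ => ‖p + s • e‖) (inner ℝ (p + t • e) e / ‖p + t • e‖) t := by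
  have h1 : HasDerivAt (fun s : ℝ => p + s • e) e t := by
    simpa using ((hasDerivAt_id t).smul_const e).const_add p
  have h2 := h1.norm_sq.sqrt (by simpa using h)
  simp only [Real.sqrt_sq (norm_nonneg _)] at h2
  convert h2 using 1
  rw [mul_div_mul_left _ _ two_ne_zero]

variable [MeasurableSpace E] [BorelSpace E] [FiniteDimensional ℝ E]

/-- Preimages of null sets under the phase `x ↦ |x - y| - |x - y'|` are null. -/
theorem volume_phase_preimage_eq_zero (hdim : 1 < Module.finrank ℝ E) {y y' : E} (hy : y ≠ y')
    {N : Set ℝ} (hN : MeasurableSet N) (hN0 : volume N = 0) :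
    volume {x : E | ‖x - y‖ - ‖x - y'‖ ∈ N} = 0 := by
  set e := y - y' with he
  have he0 : e ≠ 0 := sub_ne_zero.2 hy
  set L : Submodule ℝ E := Submodule.span ℝ {e} with hL
  -- The line through `y` and `y'` is set aside: the phase is constant on parts of it. It is null
  -- because the dimension exceeds one.
  set A : Set E := {x | x - y ∈ L} with hA
  have hLt : L ≠ ⊤ := fun h => by
    have h1 : Module.finrank ℝ L ≤ 1 := by
      rw [hL, finrank_span_singleton he0]
    rw [h, finrank_top] at h1
    omega
  have hAm : MeasurableSet A :=
    (L.closed_of_finiteDimensional.measurableSet).preimage (measurable_sub_const y)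
  have hA0 : volume A = 0 := by
    have : A = (fun x => x + -y) ⁻¹' (L : Set E) := by
      ext x
      simp [hA, sub_eq_add_neg]
    rw [this, measure_preimage_add_right]
    exact Measure.addHaar_submodule _ _ hLt
  set S : Set E := {x : E | ‖x - y‖ - ‖x - y'‖ ∈ N} with hS
  have hSm : MeasurableSet S := by
    have : Measurable fun x : E => ‖x - y‖ - ‖x - y'‖ := by fun_prop
    exact this hN
  have hBm : MeasurableSet (S \ A) := hSm.diff hAm
  suffices hB : volume (S \ A) = 0 from
    measure_mono_null (Set.subset_sdiff_union S A) (measure_union_null hB hA0)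
  have hline : ∀ x : E, volume {t : ℝ | x + t • e ∈ S \ A} = 0 := fun x => by
    by_cases hx : x ∈ A
    · convert measure_empty (μ := volume)
      rw [Set.eq_empty_iff_forall_notMem]
      rintro t ⟨-, ht⟩
      apply ht
      change x + t • e - y ∈ L
      rw [add_sub_right_comm]
      exact L.add_mem hx (L.smul_mem _ (Submodule.mem_span_singleton_self e))
    · have hp : ∀ t : ℝ, x - y + t • e ∉ L := fun t ht => hx (by
        have := L.sub_mem ht (L.smul_mem t (Submodule.mem_span_singleton_self e))
        simpa [hA] using this)
      have hp' : ∀ t : ℝ, x - y' + t • e = x - y + t • e + e := fun t => by rw [he]; abel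
      have hne : ∀ t : ℝ, x - y + t • e ≠ 0 := fun t h => hp t (h ▸ L.zero_mem)
      have hne' : ∀ t : ℝ, x - y' + t • e ≠ 0 := fun t h => hp t (by
        rw [hp' t] at h
        rw [eq_neg_of_add_eq_zero_left h]
        exact L.neg_mem (Submodule.mem_span_singleton_self e))
      -- The phase strictly decreases in the direction `y - y'`, so its negative is used, with `-N`
      -- in place of `N`.
      refine measure_mono_null ?_ (volume_preimage_eq_zero_of_deriv_pos
        (f := fun t : ℝ => ‖x - y' + t • e‖ - ‖x - y + t • e‖)
        (fun t => (hasDerivAt_norm_add_smul (hne' t)).sub (hasDerivAt_norm_add_smul (hne t)))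
        (fun t => ?_) hN.neg (by rwa [Measure.measure_neg]))
      · rintro t ⟨ht, -⟩
        have : ‖x + t • e - y‖ - ‖x + t • e - y'‖ ∈ N := ht
        rw [add_sub_right_comm, add_sub_right_comm] at this
        simpa using this
      · rw [hp' t]
        exact sub_pos.2 (inner_div_norm_lt_inner_add_div_norm he0 (hp t))
  have hprod : Measurable fun q : ℝ × E => (S \ A).indicator (1 : E → ℝ≥0∞) (q.2 + q.1 • e) :=
    (measurable_one.indicator hBm).comp (by fun_prop)
  -- Fubini without coordinates: the volume is invariant under translation by `t • e`, so averaging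
  -- over `t ∈ [0, 1]` and swapping integrals reduces it to the null slices of `hline`.
  have key : ∫⁻ _t : ℝ in Set.Icc 0 1, volume (S \ A) = 0 := by
    calc ∫⁻ _t : ℝ in Set.Icc 0 1, volume (S \ A)
        = ∫⁻ t : ℝ in Set.Icc 0 1, ∫⁻ x : E, (S \ A).indicator 1 (x + t • e) := by
          refine lintegral_congr fun t => ?_
          rw [lintegral_add_right_eq_self (fun x => (S \ A).indicator (1 : E → ℝ≥0∞) x) (t • e),
            lintegral_indicator_one hBm]
      _ = ∫⁻ x : E, ∫⁻ t : ℝ in Set.Icc 0 1, (S \ A).indicator 1 (x + t • e) :=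
          lintegral_lintegral_swap hprod.aemeasurable
      _ = ∫⁻ x : E, 0 := by
          refine lintegral_congr fun x => ?_
          refine le_antisymm ((setLIntegral_le_lintegral _ _).trans (le_of_eq ?_)) zero_le
          have hm : MeasurableSet {t : ℝ | x + t • e ∈ S \ A} :=
            hBm.preimage (f := fun t : ℝ => x + t • e) (by fun_prop)
          rw [← hline x, ← lintegral_indicator_one hm]
          rfl
      _ = 0 := lintegral_zero
  simpa using key

end Phase

/-- Riemann–Lebesgue lemma for a phase function whose law is absolutely continuous. -/
theorem tendsto_integral_exp_phase_atTop {X : Type*} [MeasurableSpace X] {ρ : Measure X}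
    [IsFiniteMeasure ρ] {h : X → ℝ} (hh : Measurable h)
    (hac : ∀ N : Set ℝ, MeasurableSet N → volume N = 0 → ρ (h ⁻¹' N) = 0) :
    Filter.Tendsto (fun k : ℝ => ∫ x, Complex.exp (Complex.I * ((k * h x : ℝ) : ℂ)) ∂ρ)
      Filter.atTop (nhds 0) := by
  have hmac : ρ.map h ≪ volume := Measure.AbsolutelyContinuous.mk fun N hN hN0 => by
    rw [Measure.map_apply hh hN]; exact hac N hN hN0
  have hRL := Real.tendsto_integral_exp_smul_cocompact
    (fun v : ℝ => (((ρ.map h).rnDeriv volume v).toReal : ℂ))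
  -- The Fourier character is `e^{-2πi s w}`, so `e^{iks}` corresponds to the frequency `w = -k /
  -- (2π)`.
  have hlin : Filter.Tendsto (fun k : ℝ => -(2 * Real.pi)⁻¹ * k) Filter.atTop
      (Filter.cocompact ℝ) := by
    refine Filter.Tendsto.mono_right ?_ atBot_le_cocompact
    exact Filter.tendsto_id.const_mul_atTop_of_neg (by
      have := Real.pi_pos
      simp [this])
  refine (hRL.comp hlin).congr fun k => ?_
  rw [← integral_map (f := fun s : ℝ => Complex.exp (Complex.I * ((k * s : ℝ) : ℂ)))
    hh.aemeasurable (by fun_prop)]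
  conv_rhs => rw [← Measure.withDensity_rnDeriv_eq _ _ hmac]
  rw [integral_withDensity_eq_integral_toReal_smul (Measure.measurable_rnDeriv _ _)
    (Measure.rnDeriv_lt_top _ _)]
  refine integral_congr_ae (Filter.Eventually.of_forall fun s => ?_)
  simp only [Circle.smul_def, Real.fourierChar_apply, smul_eq_mul, Complex.real_smul]
  have := Real.pi_ne_zero
  have h2 : 2 * Real.pi * -(s * (-(2 * Real.pi)⁻¹ * k)) = k * s := by field_simp
  rw [h2, mul_comm, mul_comm Complex.I]

/-! ### The resolvent on functions supported in a bounded set -/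

section Bounded

variable {D : Set Space}

theorem exists_bracket_rpow_le (hD : Bornology.IsBounded D) (s : ℝ) :
    ∃ c : ℝ≥0, ∀ x ∈ D, bracket x ^ s ≤ c := by
  obtain ⟨b, hb⟩ := hD.isCompact_closure.exists_bound_of_continuousOn
    (continuous_bracket_rpow s).continuousOn
  exact ⟨b.toNNReal, fun x hx => (le_abs_self _).trans
    ((hb x (subset_closure hx)).trans (Real.le_coe_toNNReal b))⟩

/-- Every power of the bracket is bounded below on a bounded set, so on `D` all the weights are
interchangeable. -/
theorem exists_setLIntegral_le_weightedMeasure (hD : Bornology.IsBounded D) (hDm : MeasurableSet D)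
    (s : ℝ) : ∃ c : ℝ≥0, ∀ g : Space → ℝ≥0∞,
      ∫⁻ x in D, g x ≤ c * ∫⁻ x, g x ∂weightedMeasure s := by
  obtain ⟨c, hc⟩ := exists_bracket_rpow_le hD (-(2 * s))
  refine ⟨c, fun g => ?_⟩
  rw [lintegral_weightedMeasure, ← lintegral_const_mul' _ _ ENNReal.coe_ne_top]
  refine (setLIntegral_mono' hDm fun x hx => ?_).trans (setLIntegral_le_lintegral D _)
  have hb := bracket_pos x
  rw [← mul_assoc, ← ENNReal.ofReal_coe_nnreal, ← ENNReal.ofReal_mul c.coe_nonneg]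
  refine le_mul_of_one_le_left zero_le ?_
  rw [ENNReal.one_le_ofReal]
  have h := mul_le_mul_of_nonneg_right (hc x hx) (Real.rpow_nonneg hb.le (2 * s))
  rwa [← Real.rpow_add hb, neg_add_cancel, Real.rpow_zero] at h

theorem setLIntegral_fundamentalSolution_lt_top (hD : Bornology.IsBounded D)
    (hDm : MeasurableSet D) (k : ℝ) (x : Space) :
    ∫⁻ y in D, ‖fundamentalSolution k x y‖ₑ ^ 2 < ∞ := by
  -- Any positive `ε` would do here; the symmetry of `|Φ_k|` lets the estimate in the first variable
  -- serve for the second.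
  obtain ⟨c, hc⟩ := exists_setLIntegral_le_weightedMeasure hD hDm (-(1 / 2) - 1)
  obtain ⟨C, hC⟩ := exists_lintegral_fundamentalSolution_le (ε := 1) one_pos
  refine (hc _).trans_lt (ENNReal.mul_lt_top ENNReal.coe_lt_top ?_)
  simp_rw [enorm_fundamentalSolution_comm k x]
  exact (hC k x).trans_lt (ENNReal.mul_lt_top ENNReal.coe_lt_top ENNReal.ofReal_lt_top)

theorem exists_lintegral_fundamentalSolution_le_of_mem (hD : Bornology.IsBounded D) {ε : ℝ}
    (hε : 0 < ε) : ∃ C : ℝ≥0, ∀ (k : ℝ), ∀ y ∈ D,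
      ∫⁻ x, ‖fundamentalSolution k x y‖ₑ ^ 2 ∂weightedMeasure (-(1 / 2) - ε) ≤ C := by
  obtain ⟨C, hC⟩ := exists_lintegral_fundamentalSolution_le hε
  obtain ⟨c, hc⟩ := exists_bracket_rpow_le hD (1 + 2 * ε)
  refine ⟨C * c, fun k y hy => (hC k y).trans ?_⟩
  rw [ENNReal.coe_mul]
  gcongr
  exact ENNReal.ofReal_le_of_le_toReal (hc y hy)

/-- The resolvent is Hilbert–Schmidt from `L²(D)` to `L²_{-1/2-ε}`, uniformly in the wave number. -/
theorem exists_lintegral_prod_fundamentalSolution_le (hD : Bornology.IsBounded D)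
    (hDm : MeasurableSet D) {ε : ℝ} (hε : 0 < ε) : ∃ H : ℝ≥0, ∀ k : ℝ,
      ∫⁻ p, ‖fundamentalSolution k p.1 p.2‖ₑ ^ 2
        ∂(weightedMeasure (-(1 / 2) - ε)).prod (volume.restrict D) ≤ H := by
  obtain ⟨C, hC⟩ := exists_lintegral_fundamentalSolution_le_of_mem hD hε
  refine ⟨C * (volume D).toNNReal, fun k => ?_⟩
  rw [lintegral_prod_symm _ (((measurable_fundamentalSolution_uncurry k).enorm.pow_const
    2).aemeasurable), ENNReal.coe_mul, ENNReal.coe_toNNReal hD.measure_lt_top.ne,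
    ← setLIntegral_const]
  exact setLIntegral_mono' hDm fun y hy => hC k y hy

theorem resolvent_eq_setIntegral (k : ℝ) {φ : Space → ℂ} (hφ : ∀ y ∉ D, φ y = 0) (x : Space) :
    resolvent k φ x = ∫ y in D, fundamentalSolution k x y * φ y :=
  (setIntegral_eq_integral_of_forall_compl_eq_zero fun y hy => by rw [hφ y hy, mul_zero]).symm

theorem setLIntegral_enorm_sq_eq {φ : Space → ℂ} (hφ : ∀ y ∉ D, φ y = 0) :
    ∫⁻ y in D, ‖φ y‖ₑ ^ 2 = ∫⁻ y, ‖φ y‖ₑ ^ 2 := by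
  refine setLIntegral_eq_of_support_subset fun y hy => ?_
  by_contra h
  exact hy (by simp [hφ y h])

theorem integrable_fundamentalSolution_mul (hD : Bornology.IsBounded D) (hDm : MeasurableSet D)
    (k : ℝ) (x : Space) {φ : Space → ℂ} (hφ : ∀ y ∉ D, φ y = 0) (hφ2 : MemLp φ 2 volume) :
    Integrable fun y => fundamentalSolution k x y * φ y := by
  have h : IntegrableOn (fun y => fundamentalSolution k x y * φ y) D := by
    refine integrable_mul_of_lintegral_sq_lt_top ?_ hφ2.1.restrict
      (setLIntegral_fundamentalSolution_lt_top hD hDm k x) ?_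
    · exact (measurable_fundamentalSolution k measurable_const measurable_id).aestronglyMeasurable
    · rw [setLIntegral_enorm_sq_eq hφ, ← eLpNorm_two_sq]
      exact ENNReal.pow_lt_top hφ2.2
  exact (integrableOn_iff_integrable_of_support_subset fun y hy => by
    by_contra hyD
    exact hy (by simp [hφ y hyD])).1 h

theorem resolvent_add (hD : Bornology.IsBounded D) (hDm : MeasurableSet D) (k : ℝ)
    {φ ψ : Space → ℂ} (hφ : ∀ y ∉ D, φ y = 0) (hφ2 : MemLp φ 2 volume)
    (hψ : ∀ y ∉ D, ψ y = 0) (hψ2 : MemLp ψ 2 volume) (x : Space) :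
    resolvent k (fun y => φ y + ψ y) x = resolvent k φ x + resolvent k ψ x := by
  unfold resolvent
  simp_rw [mul_add]
  exact integral_add (integrable_fundamentalSolution_mul hD hDm k x hφ hφ2)
    (integrable_fundamentalSolution_mul hD hDm k x hψ hψ2)

theorem resolvent_const_mul (k : ℝ) (a : ℂ) (φ : Space → ℂ) (x : Space) :
    resolvent k (fun y => a * φ y) x = a * resolvent k φ x := by
  unfold resolvent
  simp_rw [mul_left_comm _ a]
  exact integral_const_mul _ _

theorem resolvent_congr_ae (k : ℝ) {φ ψ : Space → ℂ} (h : φ =ᵐ[volume] ψ) (x : Space) :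
    resolvent k φ x = resolvent k ψ x :=
  integral_congr_ae (h.mono fun y hy => by simp only [hy])

theorem measurable_resolvent (k : ℝ) {φ : Space → ℂ} (hφ : AEStronglyMeasurable φ volume) :
    Measurable (resolvent k φ) := by
  have h : resolvent k φ = resolvent k (hφ.mk φ) :=
    funext fun x => resolvent_congr_ae k hφ.ae_eq_mk x
  rw [h]
  have hm : StronglyMeasurable fun p : Space × Space =>
      fundamentalSolution k p.1 p.2 * hφ.mk φ p.2 :=
    ((measurable_fundamentalSolution_uncurry k).mul
      (hφ.stronglyMeasurable_mk.measurable.comp measurable_snd)).stronglyMeasurable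
  exact hm.integral_prod_right'.measurable

/-- For sources in `D` the Hilbert–Schmidt bound takes the place of Agmon's estimate. It does not
decay in `k`, but its uniformity is what makes the final constant independent of `k`. -/
theorem exists_eLpNorm_resolvent_le (hD : Bornology.IsBounded D) (hDm : MeasurableSet D)
    {ε : ℝ} (hε : 0 < ε) : ∃ H : ℝ≥0, ∀ (k : ℝ) (φ : Space → ℂ), (∀ y ∉ D, φ y = 0) →
      AEStronglyMeasurable φ volume →
      weightedNorm (-(1 / 2) - ε) (resolvent k φ) ≤ H * eLpNorm φ 2 volume := by
  obtain ⟨H, hH⟩ := exists_lintegral_prod_fundamentalSolution_le hD hDm hε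
  refine ⟨NNReal.sqrt H, fun k φ hφ hφm => ?_⟩
  rw [weightedNorm_eq, ← (ENNReal.pow_right_strictMono two_ne_zero).le_iff_le]
  rw [mul_pow, eLpNorm_two_sq, eLpNorm_two_sq, ← ENNReal.coe_pow, NNReal.sq_sqrt,
    ← setLIntegral_enorm_sq_eq hφ]
  simp_rw [resolvent_eq_setIntegral k hφ]
  refine (lintegral_enorm_integral_sq_le (measurable_fundamentalSolution_uncurry k)
    hφm.restrict).trans ?_
  gcongr
  exact hH k

/-- The resolvent depends continuously on the wave number in the Hilbert–Schmidt norm. -/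
theorem tendsto_lintegral_fundamentalSolution_sub (hD : Bornology.IsBounded D)
    (hDm : MeasurableSet D) {ε : ℝ} (hε : 0 < ε) (k : ℝ) :
    Filter.Tendsto (fun l => ∫⁻ p, ‖fundamentalSolution l p.1 p.2 - fundamentalSolution k p.1 p.2‖ₑ
      ^ 2 ∂(weightedMeasure (-(1 / 2) - ε)).prod (volume.restrict D)) (nhds k) (nhds 0) := by
  obtain ⟨H, hH⟩ := exists_lintegral_prod_fundamentalSolution_le hD hDm hε
  -- The majorant `4 |Φ_k|²` does not depend on `l`, since `|Φ_l| = |Φ_k|`.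
  have h := tendsto_lintegral_filter_of_dominated_convergence
    (μ := (weightedMeasure (-(1 / 2) - ε)).prod (volume.restrict D)) (l := nhds k)
    (F := fun l p => ‖fundamentalSolution l p.1 p.2 - fundamentalSolution k p.1 p.2‖ₑ ^ 2)
    (f := fun _ => 0) (fun p => 4 * ‖fundamentalSolution k p.1 p.2‖ₑ ^ 2) ?_ ?_ ?_ ?_
  · simpa using h
  · exact Filter.Eventually.of_forall fun l => ((measurable_fundamentalSolution_uncurry l).sub
      (measurable_fundamentalSolution_uncurry k)).enorm.pow_const 2
  · refine Filter.Eventually.of_forall fun l => Filter.Eventually.of_forall fun p => ?_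
    refine (pow_le_pow_left₀ zero_le enorm_sub_le 2).trans (le_of_eq ?_)
    rw [enorm_fundamentalSolution_eq l k, ← two_mul, mul_pow]
    norm_num
  · rw [lintegral_const_mul' _ _ (by norm_num)]
    exact (ENNReal.mul_lt_top (by norm_num) ((hH k).trans_lt ENNReal.coe_lt_top)).ne
  · refine Filter.Eventually.of_forall fun p => ?_
    have hc : Continuous fun l => ‖fundamentalSolution l p.1 p.2 -
        fundamentalSolution k p.1 p.2‖ₑ ^ 2 := by
      unfold fundamentalSolution
      refine (ENNReal.continuous_pow 2).comp (Continuous.enorm ?_)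
      fun_prop
    have := hc.tendsto k
    simpa using this

/-! ### High wave numbers: decay of `R_k* R_k`. -/

theorem conj_fundamentalSolution_mul (k : ℝ) (x y y' : Space) :
    starRingEnd ℂ (fundamentalSolution k x y) * fundamentalSolution k x y' =
      ((4 * Real.pi * ‖x - y‖)⁻¹ * (4 * Real.pi * ‖x - y'‖)⁻¹ : ℝ) *
        Complex.exp (Complex.I * ((k * (‖x - y'‖ - ‖x - y‖) : ℝ) : ℂ)) := by
  unfold fundamentalSolution
  rw [map_div₀, ← Complex.exp_conj, map_mul, Complex.conj_I, Complex.conj_ofReal,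
    Complex.conj_ofReal, div_mul_div_comm, ← Complex.exp_add, div_eq_mul_inv, mul_comm]
  congr 1
  · push_cast
    rw [mul_inv]
  · congr 1
    push_cast
    ring

/-- The amplitude of the product is independent of `k` and, by Cauchy–Schwarz, is the density of a
finite measure; what is left is a Riemann–Lebesgue integral for the phase `|x - y'| - |x - y|`. -/
theorem tendsto_integral_conj_fundamentalSolution_mul {ε : ℝ} (hε : 0 < ε) {y y' : Space}
    (hy : y ≠ y') : Filter.Tendsto (fun k : ℝ => ∫ x, starRingEnd ℂ (fundamentalSolution k x y) *
      fundamentalSolution k x y' ∂weightedMeasure (-(1 / 2) - ε)) Filter.atTop (nhds 0) := by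
  set μ := weightedMeasure (-(1 / 2) - ε) with hμ
  set G : Space → ℝ := fun x => (4 * Real.pi * ‖x - y‖)⁻¹ * (4 * Real.pi * ‖x - y'‖)⁻¹ with hG
  have hGm : Measurable G := by fun_prop
  have hG0 : ∀ x, 0 ≤ G x := fun x => by positivity
  set ρ := μ.withDensity fun x => ENNReal.ofReal (G x) with hρ
  have hfin : ∫⁻ x, ENNReal.ofReal (G x) ∂μ < ∞ := by
    obtain ⟨C, hC⟩ := exists_lintegral_fundamentalSolution_le hε
    have h := lintegral_mul_sq_le (μ := μ) (f := fun x => ‖fundamentalSolution 0 x y‖ₑ)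
      (g := fun x => ‖fundamentalSolution 0 x y'‖ₑ)
      (by fun_prop) (by fun_prop)
    have h2 := h.trans_lt (ENNReal.mul_lt_top
      ((hC 0 y).trans_lt (ENNReal.mul_lt_top ENNReal.coe_lt_top ENNReal.ofReal_lt_top))
      ((hC 0 y').trans_lt (ENNReal.mul_lt_top ENNReal.coe_lt_top ENNReal.ofReal_lt_top)))
    have h3 := (ENNReal.pow_lt_top_iff.1 h2).resolve_right two_ne_zero
    refine lt_of_eq_of_lt (lintegral_congr fun x => ?_) h3
    rw [enorm_fundamentalSolution, enorm_fundamentalSolution, ← ENNReal.ofReal_mul (by positivity)]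
  have : IsFiniteMeasure ρ := isFiniteMeasure_withDensity hfin.ne
  have hac : ρ ≪ volume :=
    (withDensity_absolutelyContinuous _ _).trans (weightedMeasure_absolutelyContinuous _)
  have h := tendsto_integral_exp_phase_atTop (ρ := ρ) (h := fun x => ‖x - y'‖ - ‖x - y‖)
    (by fun_prop) fun N hN hN0 =>
      hac (volume_phase_preimage_eq_zero (by simp) hy.symm hN hN0)
  refine h.congr fun k => ?_
  rw [hρ, integral_withDensity_eq_integral_toReal_smul hGm.ennreal_ofReal
    (Filter.Eventually.of_forall fun x => ENNReal.ofReal_lt_top)]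
  refine integral_congr_ae (Filter.Eventually.of_forall fun x => ?_)
  simp only
  rw [conj_fundamentalSolution_mul, ENNReal.toReal_ofReal (hG0 x), Complex.real_smul]

theorem measurable_integral_conj_fundamentalSolution_mul (k : ℝ) (μ : Measure Space)
    [SFinite μ] : Measurable fun q : Space × Space =>
      ∫ x, starRingEnd ℂ (fundamentalSolution k x q.1) * fundamentalSolution k x q.2 ∂μ := by
  have : Measurable fun p : (Space × Space) × Space =>
      starRingEnd ℂ (fundamentalSolution k p.2 p.1.1) * fundamentalSolution k p.2 p.1.2 := by
    fun_prop
  exact (this.stronglyMeasurable.integral_prod_right').measurable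

theorem enorm_integral_conj_fundamentalSolution_mul_sq_le (k : ℝ) (μ : Measure Space)
    (y y' : Space) :
    ‖∫ x, starRingEnd ℂ (fundamentalSolution k x y) * fundamentalSolution k x y' ∂μ‖ₑ ^ 2 ≤
      (∫⁻ x, ‖fundamentalSolution k x y‖ₑ ^ 2 ∂μ) * ∫⁻ x, ‖fundamentalSolution k x y'‖ₑ ^ 2 ∂μ := by
  have h1 : Measurable fun x => starRingEnd ℂ (fundamentalSolution k x y) := by fun_prop
  have h2 : Measurable fun x => fundamentalSolution k x y' := by fun_prop
  refine (enorm_integral_mul_sq_le h1.aestronglyMeasurable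
    h2.aestronglyMeasurable).trans (le_of_eq ?_)
  congr 1
  exact lintegral_congr fun x => by rw [RCLike.enorm_conj]

/-- On the diagonal the phase vanishes and there is no decay; the diagonal is negligible. -/
theorem ae_restrict_prod_ne (hDm : MeasurableSet D) :
    ∀ᵐ q ∂(volume.restrict D : Measure Space).prod (volume.restrict D),
      q.1 ∈ D ∧ q.2 ∈ D ∧ q.1 ≠ q.2 := by
  have h1 : ∀ᵐ y ∂(volume.restrict D : Measure Space), y ∈ D := ae_restrict_mem hDm
  have h2 : ∀ᵐ q ∂(volume.restrict D : Measure Space).prod (volume.restrict D), q.1 ≠ q.2 := by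
    refine (Measure.ae_prod_iff_ae_ae
      (measurableSet_eq_fun measurable_fst measurable_snd).compl).2 ?_
    refine Filter.Eventually.of_forall fun y => ?_
    have : ∀ᵐ y' ∂(volume.restrict D : Measure Space), y' ≠ y :=
      ae_restrict_of_ae (Measure.ae_ne volume y)
    exact this.mono fun y' h => h.symm
  filter_upwards [Measure.quasiMeasurePreserving_fst.ae h1,
    Measure.quasiMeasurePreserving_snd.ae h1, h2] with q a b c using ⟨a, b, c⟩

/-- The Hilbert–Schmidt norm of `R_k* R_k` on `L²(D)` tends to zero as the wave number tends to
infinity. -/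
theorem tendsto_lintegral_integral_conj_fundamentalSolution_mul (hD : Bornology.IsBounded D)
    (hDm : MeasurableSet D) {ε : ℝ} (hε : 0 < ε) :
    Filter.Tendsto (fun k : ℝ => ∫⁻ q, ‖∫ x, starRingEnd ℂ (fundamentalSolution k x q.1) *
      fundamentalSolution k x q.2 ∂weightedMeasure (-(1 / 2) - ε)‖ₑ ^ 2
        ∂(volume.restrict D).prod (volume.restrict D)) Filter.atTop (nhds 0) := by
  obtain ⟨C, hC⟩ := exists_lintegral_fundamentalSolution_le_of_mem hD hε
  have hfin : ∫⁻ _, (C : ℝ≥0∞) * C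
      ∂(volume.restrict D : Measure Space).prod (volume.restrict D) ≠ ∞ := by
    rw [lintegral_const, Measure.prod_apply MeasurableSet.univ]
    simp only [Set.preimage_univ, Measure.restrict_apply_univ, lintegral_const]
    exact (ENNReal.mul_lt_top (ENNReal.mul_lt_top ENNReal.coe_lt_top ENNReal.coe_lt_top)
      (ENNReal.mul_lt_top hD.measure_lt_top hD.measure_lt_top)).ne
  have hoff := ae_restrict_prod_ne hDm
  rw [← lintegral_zero (μ := (volume.restrict D : Measure Space).prod (volume.restrict D))]
  refine tendsto_lintegral_filter_of_dominated_convergence (fun _ => (C : ℝ≥0∞) * C)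
    (Filter.Eventually.of_forall fun k =>
      (measurable_integral_conj_fundamentalSolution_mul k _).enorm.pow_const 2)
    (Filter.Eventually.of_forall fun k => ?_) hfin ?_
  · filter_upwards [hoff] with q hq
    exact (enorm_integral_conj_fundamentalSolution_mul_sq_le k _ q.1 q.2).trans
      (mul_le_mul' (hC k q.1 hq.1) (hC k q.2 hq.2.1))
  · filter_upwards [hoff] with q hq
    have h := (tendsto_integral_conj_fundamentalSolution_mul hε hq.2.2).enorm
    have h2 := ((ENNReal.continuous_pow 2).tendsto _).comp h
    simpa [Function.comp_def] using h2

/-- The operator norm of the resolvent from `L²(D)` to `L²_{-1/2-ε}` tends to zero as the wave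
number tends to infinity. -/
theorem eventually_weightedNorm_resolvent_le (hD : Bornology.IsBounded D) (hDm : MeasurableSet D)
    {ε : ℝ} (hε : 0 < ε) {δ : ℝ≥0} (hδ : 0 < δ) : ∀ᶠ k : ℝ in Filter.atTop,
      ∀ φ : Space → ℂ, (∀ y ∉ D, φ y = 0) → MemLp φ 2 volume →
        weightedNorm (-(1 / 2) - ε) (resolvent k φ) ≤ δ * eLpNorm φ 2 volume := by
  set μ := weightedMeasure (-(1 / 2) - ε) with hμ
  set ν := (volume.restrict D : Measure Space) with hν
  obtain ⟨H, hH⟩ := exists_lintegral_prod_fundamentalSolution_le hD hDm hε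
  have htend := tendsto_lintegral_integral_conj_fundamentalSolution_mul hD hDm hε
  -- The fourth power: the squared Hilbert–Schmidt norm of `R_k* R_k` bounds the fourth power of the
  -- norm of `R_k`.
  have hδ' : (0 : ℝ≥0∞) < (δ : ℝ≥0∞) ^ 4 := by positivity
  filter_upwards [htend.eventually_lt_const hδ'] with k hk φ hφ hφ2
  have hmk := hφ2.1.ae_eq_mk
  set φ' := hφ2.1.mk φ with hφ'
  have hmk' : φ =ᵐ[ν] φ' := ae_restrict_of_ae hmk
  have hE : ∫⁻ y, ‖φ' y‖ₑ ^ 2 ∂ν = eLpNorm φ 2 volume ^ 2 := by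
    rw [eLpNorm_two_sq, ← setLIntegral_enorm_sq_eq hφ]
    exact lintegral_congr_ae (hmk'.mono fun y hy => by simp only [hy])
  have hR : ∀ x, resolvent k φ x = ∫ y, fundamentalSolution k x y * φ' y ∂ν := fun x => by
    rw [resolvent_eq_setIntegral k hφ]
    exact integral_congr_ae (hmk'.mono fun y hy => by simp only [hy])
  have h := sq_lintegral_enorm_integral_sq_le (μ := μ) (ν := ν)
    (measurable_fundamentalSolution_uncurry k) ((hH k).trans_lt ENNReal.coe_lt_top)
    hφ2.1.stronglyMeasurable_mk.measurable (by rw [hE]; exact ENNReal.pow_lt_top hφ2.2)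
  rw [weightedNorm_eq, ← (ENNReal.pow_right_strictMono (n := 4) (by norm_num)).le_iff_le]
  have e : ∀ a : ℝ≥0∞, a ^ 4 = (a ^ 2) ^ 2 := fun a => by rw [← pow_mul]
  rw [mul_pow, e (eLpNorm _ _ _), e (eLpNorm φ _ _), eLpNorm_two_sq, ← hE]
  simp_rw [hR]
  refine h.trans ?_
  gcongr

end Bounded

/-! ### Neumann series -/

section Neumann

variable {X : Type*} [MeasurableSpace X] {μ : Measure X}

/-- In `ℂ` summability is absolute summability, a measurable condition, and `∑'` is `0` where it
fails; so partial sums cut off to that set converge everywhere. -/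
theorem measurable_tsum_complex {f : ℕ → X → ℂ} (hf : ∀ n, Measurable (f n)) :
    Measurable fun x => ∑' n, f n x := by
  set S : Set X := {x | ∑' n, ‖f n x‖ₑ < ∞} with hS
  have hSm : MeasurableSet S :=
    measurableSet_lt (Measurable.tsum fun n => (hf n).enorm) measurable_const
  have hsum : ∀ x, x ∈ S ↔ Summable fun n => f n x := fun x => by
    rw [← summable_norm_iff, ← tsum_enorm_ne_top_iff_summable_norm, ← lt_top_iff_ne_top]
    rfl
  refine measurable_of_tendsto_metrizable
    (f := fun N => S.indicator fun x => ∑ n ∈ Finset.range N, f n x)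
    (fun N => (Finset.measurable_fun_sum _ fun n _ => hf n).indicator hSm)
    (tendsto_pi_nhds.2 fun x => ?_)
  by_cases hx : x ∈ S
  · simp_rw [Set.indicator_of_mem hx]
    exact ((hsum x).1 hx).hasSum.tendsto_sum_nat
  · simp_rw [Set.indicator_of_notMem hx]
    rw [tsum_eq_zero_of_not_summable fun h => hx ((hsum x).2 h)]
    exact tendsto_const_nhds

theorem eLpNorm_tsum_le_tsum {f : ℕ → X → ℂ} (hf : ∀ n, AEStronglyMeasurable (f n) μ)
    (hfs : ∑' n, eLpNorm (f n) 2 μ ≠ ∞) :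
    eLpNorm (fun x => ∑' n, f n x) 2 μ ≤ ∑' n, eLpNorm (f n) 2 μ := by
  have hs := summable_norm_of_tsum_eLpNorm_ne_top (by norm_num) hf hfs
  refine Lp.eLpNorm_le_of_ae_tendsto (u := Filter.atTop)
    (f := fun N x => ∑ n ∈ Finset.range N, f n x)
    (Filter.Eventually.of_forall fun N => ?_) (fun N => ?_) ?_
  · have h := eLpNorm_sum_le (s := Finset.range N) (f := f) (p := 2) (μ := μ) (fun i _ => hf i)
      (by norm_num)
    have e : (∑ i ∈ Finset.range N, f i) = fun x => ∑ n ∈ Finset.range N, f n x :=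
      funext fun x => Finset.sum_apply _ _ _
    rw [e] at h
    exact h.trans (ENNReal.sum_le_tsum _)
  · exact Finset.aestronglyMeasurable_fun_sum _ fun n _ => hf n
  · filter_upwards [hs] with x hx
    exact hx.of_norm.hasSum.tendsto_sum_nat

theorem aestronglyMeasurable_tsum {f : ℕ → X → ℂ} (hf : ∀ n, AEStronglyMeasurable (f n) μ) :
    AEStronglyMeasurable (fun x => ∑' n, f n x) μ := by
  refine ⟨fun x => ∑' n, (hf n).mk (f n) x, (measurable_tsum_complex fun n =>
    (hf n).stronglyMeasurable_mk.measurable).stronglyMeasurable, ?_⟩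
  filter_upwards [ae_all_iff.2 fun n => (hf n).ae_eq_mk] with x hx
  simp_rw [hx]

/-- The Neumann series of a contraction `A` on `L²` solves `u - A u = g`. -/
theorem neumann_series {A : (X → ℂ) → X → ℂ} {c : ℝ≥0} (hc1 : c < 1)
    (hAm : ∀ u, MemLp u 2 μ → AEStronglyMeasurable (A u) μ)
    (hadd : ∀ u v, MemLp u 2 μ → MemLp v 2 μ → A (fun x => u x + v x) =ᵐ[μ] fun x => A u x + A v x)
    (hcongr : ∀ u v, u =ᵐ[μ] v → A u =ᵐ[μ] A v)
    (hA : ∀ u, MemLp u 2 μ → eLpNorm (A u) 2 μ ≤ c * eLpNorm u 2 μ)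
    {g : X → ℂ} (hg : MemLp g 2 μ) :
    MemLp (fun x => ∑' n, A^[n] g x) 2 μ ∧
      eLpNorm (fun x => ∑' n, A^[n] g x) 2 μ ≤ (1 - c : ℝ≥0∞)⁻¹ * eLpNorm g 2 μ ∧
      ∀ᵐ x ∂μ, (∑' n, A^[n] g x) - A (fun x => ∑' n, A^[n] g x) x = g x := by
  have hc1' : (c : ℝ≥0∞) < 1 := by exact_mod_cast hc1
  have hinv : (1 - c : ℝ≥0∞)⁻¹ ≠ ∞ := ENNReal.inv_ne_top.2 (tsub_pos_of_lt hc1').ne'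
  have hγ : ∀ n, MemLp (A^[n] g) 2 μ ∧ eLpNorm (A^[n] g) 2 μ ≤ c ^ n * eLpNorm g 2 μ := fun n => by
    induction n with
    | zero => simpa using hg
    | succ n ih =>
      rw [Function.iterate_succ_apply']
      have h : eLpNorm (A (A^[n] g)) 2 μ ≤ c ^ (n + 1) * eLpNorm g 2 μ :=
        (hA _ ih.1).trans (by rw [pow_succ', mul_assoc]; gcongr; exact ih.2)
      exact ⟨⟨hAm _ ih.1, h.trans_lt (ENNReal.mul_lt_top (by simp) hg.2)⟩, h⟩
  have hsum : ∀ N, ∑' n, eLpNorm (A^[n + N] g) 2 μ ≤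
      c ^ N * ((1 - c : ℝ≥0∞)⁻¹ * eLpNorm g 2 μ) := fun N => by
    calc ∑' n, eLpNorm (A^[n + N] g) 2 μ ≤ ∑' n, (c : ℝ≥0∞) ^ n * (c ^ N * eLpNorm g 2 μ) :=
          ENNReal.tsum_le_tsum fun n => by rw [← mul_assoc, ← pow_add]; exact (hγ _).2
      _ = _ := by rw [ENNReal.tsum_mul_right, ENNReal.tsum_geometric]; ring
  have hfin : ∀ N, ∑' n, eLpNorm (A^[n + N] g) 2 μ ≠ ∞ := fun N =>
    ((hsum N).trans_lt (ENNReal.mul_lt_top (by simp)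
      (ENNReal.mul_lt_top hinv.lt_top hg.2))).ne
  -- The tails of the series, of size `O(c^N)`; `U 0` is the candidate solution.
  set U : ℕ → X → ℂ := fun N x => ∑' n, A^[n + N] g x with hU
  have hUb : ∀ N, eLpNorm (U N) 2 μ ≤ c ^ N * ((1 - c : ℝ≥0∞)⁻¹ * eLpNorm g 2 μ) := fun N =>
    (eLpNorm_tsum_le_tsum (fun n => (hγ _).1.1) (hfin N)).trans (hsum N)
  have hUm : ∀ N, MemLp (U N) 2 μ := fun N =>
    ⟨aestronglyMeasurable_tsum fun n => (hγ _).1.1, (hUb N).trans_lt (ENNReal.mul_lt_top (by simp)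
      (ENNReal.mul_lt_top hinv.lt_top hg.2))⟩
  have hstep : ∀ N, U N =ᵐ[μ] fun x => A^[N] g x + U (N + 1) x := fun N => by
    filter_upwards [summable_norm_of_tsum_eLpNorm_ne_top (by norm_num)
      (fun n => (hγ (n + N)).1.1) (hfin N)] with x hx
    simp only [hU]
    rw [hx.of_norm.tsum_eq_zero_add, zero_add]
    congr 1
    exact tsum_congr fun n => by rw [add_assoc, add_comm 1 N]
  -- The defect of the `N`-th tail. Additivity of `A` makes it independent of `N`, while its norm is
  -- `O(c^N)`, so it vanishes; `A` is never interchanged with an infinite sum.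
  set W : ℕ → X → ℂ := fun N x => U N x - A (U N) x - A^[N] g x with hW
  have hWstep : ∀ N, W N =ᵐ[μ] W (N + 1) := fun N => by
    filter_upwards [hstep N, hcongr _ _ (hstep N), hadd _ _ (hγ N).1 (hUm (N + 1))] with x h1 h2 h3
    simp only [hW]
    rw [h2, h3, h1, Function.iterate_succ_apply']
    ring
  have hW0 : ∀ N, W 0 =ᵐ[μ] W N := fun N => by
    induction N with
    | zero => rfl
    | succ N ih => exact ih.trans (hWstep N)
  have hWb : ∀ N, eLpNorm (W 0) 2 μ ≤
      c ^ N * ((1 + 1) * ((1 - c : ℝ≥0∞)⁻¹ * eLpNorm g 2 μ) + eLpNorm g 2 μ) := fun N => by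
    rw [eLpNorm_congr_ae (hW0 N)]
    have h1 := eLpNorm_sub_le ((hUm N).1.sub (hAm _ (hUm N))) (hγ N).1.1 (p := 2) (by norm_num)
    have h2 := eLpNorm_sub_le (hUm N).1 (hAm _ (hUm N)) (p := 2) (by norm_num)
    have h3 : eLpNorm (A (U N)) 2 μ ≤ eLpNorm (U N) 2 μ :=
      (hA _ (hUm N)).trans (mul_le_of_le_one_left zero_le hc1'.le)
    calc eLpNorm (W N) 2 μ ≤ eLpNorm (U N) 2 μ + eLpNorm (A (U N)) 2 μ + eLpNorm (A^[N] g) 2 μ :=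
          h1.trans (add_le_add_left h2 _)
      _ ≤ c ^ N * ((1 - c : ℝ≥0∞)⁻¹ * eLpNorm g 2 μ) + c ^ N * ((1 - c : ℝ≥0∞)⁻¹ * eLpNorm g 2 μ)
            + c ^ N * eLpNorm g 2 μ := by
          gcongr
          · exact hUb N
          · exact h3.trans (hUb N)
          · exact (hγ N).2
      _ = _ := by ring
  have hW00 : eLpNorm (W 0) 2 μ = 0 := by
    have hK : (1 + 1) * ((1 - c : ℝ≥0∞)⁻¹ * eLpNorm g 2 μ) + eLpNorm g 2 μ ≠ ∞ :=
      (ENNReal.add_lt_top.2 ⟨ENNReal.mul_lt_top (by norm_num)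
        (ENNReal.mul_lt_top hinv.lt_top hg.2), hg.2⟩).ne
    have ht := ENNReal.Tendsto.mul_const (b := (1 + 1) * ((1 - c : ℝ≥0∞)⁻¹ * eLpNorm g 2 μ) +
      eLpNorm g 2 μ) (ENNReal.tendsto_pow_atTop_nhds_zero_of_lt_one hc1') (Or.inr hK)
    rw [zero_mul] at ht
    exact le_antisymm (ge_of_tendsto' ht hWb) zero_le
  refine ⟨hUm 0, by have h := hUb 0; rwa [pow_zero, one_mul] at h, ?_⟩
  have hWm : AEStronglyMeasurable (W 0) μ :=
    ((hUm 0).1.sub (hAm _ (hUm 0))).sub (hγ 0).1.1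
  filter_upwards [(eLpNorm_eq_zero_iff hWm (by norm_num)).1 hW00] with x hx
  exact sub_eq_zero.1 hx

/-- Solutions of `u - A u = g` in `L²` are unique if `A` is a contraction. -/
theorem ae_eq_zero_of_contraction {c : ℝ≥0} (hc1 : c < 1) {w w' : X → ℂ} (hw : MemLp w 2 μ)
    (h : eLpNorm w' 2 μ ≤ c * eLpNorm w 2 μ) (hww' : w =ᵐ[μ] w') : w =ᵐ[μ] 0 := by
  refine (eLpNorm_eq_zero_iff hw.1 two_ne_zero).1 ?_
  rw [← eLpNorm_congr_ae hww'] at h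
  by_contra h0
  have h1 : (c : ℝ≥0∞) * eLpNorm w 2 μ < 1 * eLpNorm w 2 μ :=
    (ENNReal.mul_lt_mul_iff_left h0 hw.2.ne).2 (by exact_mod_cast hc1)
  rw [one_mul] at h1
  exact absurd h h1.not_ge

end Neumann

/-! ### The operator `R_k V` -/

section Potential

variable {D : Set Space} {V : Space → ℝ}

theorem eq_zero_of_notMem (hVD : tsupport V ⊆ D) : ∀ y ∉ D, V y = 0 := fun _ hy =>
  image_eq_zero_of_notMem_tsupport fun h => hy (hVD h)

theorem realMul_eq_zero (hV0 : ∀ y ∉ D, V y = 0) (u : Space → ℂ) : ∀ y ∉ D, realMul V u y = 0 :=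
  fun y hy => by simp [realMul, hV0 y hy]

/-- The bounded support of `V` allows any weight `s`, so the same lemma covers scattered fields and
plane waves. -/
theorem exists_eLpNorm_realMul_le (hD : Bornology.IsBounded D) (hDm : MeasurableSet D)
    (hV : MemLp V ∞ volume) (hV0 : ∀ y ∉ D, V y = 0) (s : ℝ) :
    ∃ L : ℝ≥0, ∀ u : Space → ℂ, eLpNorm (realMul V u) 2 volume ≤ L * weightedNorm s u := by
  obtain ⟨c, hc⟩ := exists_setLIntegral_le_weightedMeasure hD hDm s
  set M : ℝ≥0 := (eLpNorm V ∞ volume).toNNReal with hM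
  have hMV : ∀ᵐ y, ‖V y‖ₑ ≤ M := by
    rw [hM, ENNReal.coe_toNNReal hV.2.ne, eLpNorm_exponent_top]
    exact ae_le_eLpNormEssSup
  refine ⟨M * NNReal.sqrt c, fun u => ?_⟩
  rw [weightedNorm_eq, ← (ENNReal.pow_right_strictMono two_ne_zero).le_iff_le, mul_pow,
    eLpNorm_two_sq, eLpNorm_two_sq, ← setLIntegral_enorm_sq_eq (realMul_eq_zero hV0 u),
    ENNReal.coe_mul, mul_pow, ← ENNReal.coe_pow (NNReal.sqrt c), NNReal.sq_sqrt, mul_assoc]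
  calc ∫⁻ y in D, ‖realMul V u y‖ₑ ^ 2 ≤ ∫⁻ y in D, (M : ℝ≥0∞) ^ 2 * ‖u y‖ₑ ^ 2 := by
        refine lintegral_mono_ae (ae_restrict_of_ae ?_)
        filter_upwards [hMV] with y hy
        rw [realMul, enorm_mul, mul_pow]
        gcongr
        rwa [← ofReal_norm, Complex.norm_real, ofReal_norm]
    _ = (M : ℝ≥0∞) ^ 2 * ∫⁻ y in D, ‖u y‖ₑ ^ 2 := lintegral_const_mul' _ _ (by simp)
    _ ≤ _ := by gcongr; exact hc _

theorem aestronglyMeasurable_realMul (hV : MemLp V ∞ volume) {u : Space → ℂ}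
    (hu : AEStronglyMeasurable u volume) : AEStronglyMeasurable (realMul V u) volume :=
  (Complex.continuous_ofReal.comp_aestronglyMeasurable hV.1).mul hu

theorem MemWeightedL2.aestronglyMeasurable {s : ℝ} {u : Space → ℂ} (hu : MemWeightedL2 s u) :
    AEStronglyMeasurable u volume := hu.1.aestronglyMeasurable

theorem memLp_realMul (hD : Bornology.IsBounded D) (hDm : MeasurableSet D)
    (hV : MemLp V ∞ volume) (hV0 : ∀ y ∉ D, V y = 0) {s : ℝ} {u : Space → ℂ}
    (hu : MemWeightedL2 s u) : MemLp (realMul V u) 2 volume := by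
  obtain ⟨L, hL⟩ := exists_eLpNorm_realMul_le hD hDm hV hV0 s
  exact ⟨aestronglyMeasurable_realMul hV hu.aestronglyMeasurable,
    (hL u).trans_lt (ENNReal.mul_lt_top ENNReal.coe_lt_top hu.2)⟩

/-- `c` bounds the operator `R_k V` on `L²_{-1/2-ε}`. -/
def ResolventPotentialBound (ε k : ℝ) (V : Space → ℝ) (c : ℝ≥0∞) : Prop :=
  ∀ u : Space → ℂ, MemWeightedL2 (-(1 / 2) - ε) u →
    weightedNorm (-(1 / 2) - ε) (resolvent k (realMul V u)) ≤ c * weightedNorm (-(1 / 2) - ε) u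

theorem ResolventPotentialBound.mono {ε k : ℝ} {c c' : ℝ≥0∞} (h : ResolventPotentialBound ε k V c)
    (hcc : c ≤ c') : ResolventPotentialBound ε k V c' := fun u hu =>
  (h u hu).trans (by gcongr)

theorem ResolventPotentialBound.notMem_badWaveNumbers {ε k : ℝ} {c : ℝ≥0∞} (hc : c < 1)
    (h : ResolventPotentialBound ε k V c) : k ∉ badWaveNumbers ε V := fun hk =>
  absurd ((sInf_le h : resolventPotentialNorm ε k V ≤ c).trans_lt hc) hk.2.not_gt

theorem exists_resolventPotentialBound_of_notMem {ε k : ℝ} (hk : 0 < k)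
    (h : k ∉ badWaveNumbers ε V) : ∃ c : ℝ≥0, c < 1 ∧ ResolventPotentialBound ε k V c := by
  have h1 : resolventPotentialNorm ε k V < 1 := not_le.1 fun h1 => h ⟨hk, h1⟩
  obtain ⟨c, hc, hc1⟩ := sInf_lt_iff.1 h1
  lift c to ℝ≥0 using (hc1.trans ENNReal.one_lt_top).ne
  exact ⟨c, by exact_mod_cast hc1, hc⟩

theorem eventually_resolventPotentialBound (hD : Bornology.IsBounded D) (hDm : MeasurableSet D)
    (hV : MemLp V ∞ volume) (hV0 : ∀ y ∉ D, V y = 0) {ε : ℝ} (hε : 0 < ε) :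
    ∀ᶠ k : ℝ in Filter.atTop, ResolventPotentialBound ε k V (1 / 2 : ℝ≥0) := by
  obtain ⟨L, hL⟩ := exists_eLpNorm_realMul_le hD hDm hV hV0 (-(1 / 2) - ε)
  -- Chosen so that `δ L ≤ 1/2`; the `+ 1` covers `L = 0`.
  have hδ : (0 : ℝ≥0) < (2 * (L + 1))⁻¹ := by positivity
  filter_upwards [eventually_weightedNorm_resolvent_le hD hDm hε hδ] with k hk u hu
  refine (hk _ (realMul_eq_zero hV0 u) (memLp_realMul hD hDm hV hV0 hu)).trans ?_
  refine (mul_le_mul_right (hL u) _).trans ?_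
  rw [← mul_assoc, ← ENNReal.coe_mul]
  gcongr
  rw [inv_mul_le_iff₀ (by positivity)]
  rw [mul_comm (2 : ℝ≥0), mul_assoc]
  norm_num

/-- The set of good wave numbers is open, with a locally uniform contraction constant. -/
theorem exists_eventually_resolventPotentialBound (hD : Bornology.IsBounded D)
    (hDm : MeasurableSet D) (hV : MemLp V ∞ volume) (hV0 : ∀ y ∉ D, V y = 0) {ε : ℝ} (hε : 0 < ε)
    {k : ℝ} {c : ℝ≥0} (hc1 : c < 1) (hc : ResolventPotentialBound ε k V c) :
    ∃ c' : ℝ≥0, c' < 1 ∧ ∀ᶠ l in nhds k, ResolventPotentialBound ε l V c' := by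
  obtain ⟨L, hL⟩ := exists_eLpNorm_realMul_le hD hDm hV hV0 (-(1 / 2) - ε)
  -- The gap `c' - c` pays for the perturbation `(R_l - R_k) V`.
  obtain ⟨c', hcc', hc'1⟩ := exists_between hc1
  refine ⟨c', hc'1, ?_⟩
  have hδ : 0 < c' - c := tsub_pos_of_lt hcc'
  have ht := ENNReal.Tendsto.mul_const (b := (L : ℝ≥0∞) ^ 2)
    (tendsto_lintegral_fundamentalSolution_sub hD hDm hε k) (Or.inr (by simp))
  rw [zero_mul] at ht
  have hδ' : (0 : ℝ≥0∞) < ((c' - c : ℝ≥0) : ℝ≥0∞) ^ 2 := by positivity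
  filter_upwards [ht.eventually_lt_const hδ'] with l hl u hu
  have hφ0 := realMul_eq_zero hV0 u
  have hφ2 := memLp_realMul hD hDm hV hV0 hu
  have hdiff : eLpNorm (fun x => resolvent l (realMul V u) x - resolvent k (realMul V u) x) 2
      (weightedMeasure (-(1 / 2) - ε)) ≤ (c' - c : ℝ≥0) * weightedNorm (-(1 / 2) - ε) u := by
    rw [← (ENNReal.pow_right_strictMono two_ne_zero).le_iff_le, mul_pow, eLpNorm_two_sq]
    have e : ∀ x, resolvent l (realMul V u) x - resolvent k (realMul V u) x =
        ∫ y in D, (fundamentalSolution l x y - fundamentalSolution k x y) * realMul V u y :=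
      fun x => by
        rw [resolvent_eq_setIntegral l hφ0, resolvent_eq_setIntegral k hφ0, ← integral_sub]
        · simp_rw [sub_mul]
        · exact (integrable_fundamentalSolution_mul hD hDm l x hφ0 hφ2).integrableOn
        · exact (integrable_fundamentalSolution_mul hD hDm k x hφ0 hφ2).integrableOn
    simp_rw [e]
    refine (lintegral_enorm_integral_sq_le
      (K := fun x y => fundamentalSolution l x y - fundamentalSolution k x y) (by fun_prop)
      hφ2.1.restrict).trans ?_
    rw [setLIntegral_enorm_sq_eq hφ0, ← eLpNorm_two_sq volume (realMul V u)]
    refine (mul_le_mul_right (pow_le_pow_left₀ zero_le (hL u) 2) _).trans ?_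
    rw [mul_pow, ← mul_assoc]
    gcongr
  have hm : ∀ j, AEStronglyMeasurable (resolvent j (realMul V u))
      (weightedMeasure (-(1 / 2) - ε)) := fun j =>
    (measurable_resolvent j hφ2.1).aestronglyMeasurable
  have hsplit : resolvent l (realMul V u) = resolvent k (realMul V u) +
      fun x => resolvent l (realMul V u) x - resolvent k (realMul V u) x := by
    ext x; simp
  have hck := hc u hu
  rw [weightedNorm_eq] at hck ⊢
  rw [hsplit]
  refine (eLpNorm_add_le (hm k) ((hm l).sub (hm k)) (by norm_num)).trans
    ((add_le_add hck hdiff).trans (le_of_eq ?_))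
  rw [← add_mul, ← ENNReal.coe_add, add_tsub_cancel_of_le hcc'.le]

theorem bddAbove_badWaveNumbers (hD : Bornology.IsBounded D) (hDm : MeasurableSet D)
    (hV : MemLp V ∞ volume) (hV0 : ∀ y ∉ D, V y = 0) {ε : ℝ} (hε : 0 < ε) :
    BddAbove (badWaveNumbers ε V) := by
  obtain ⟨K, hK⟩ := Filter.eventually_atTop.1
    (eventually_resolventPotentialBound hD hDm hV hV0 hε)
  refine ⟨K, fun k hk => ?_⟩
  by_contra hkK
  exact (hK k (not_le.1 hkK).le).notMem_badWaveNumbers (by norm_num) hk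

/-- On a closed half-line of good wave numbers, `R_k V` is a contraction with a uniform constant. -/
theorem exists_uniform_resolventPotentialBound (hD : Bornology.IsBounded D) (hDm : MeasurableSet D)
    (hV : MemLp V ∞ volume) (hV0 : ∀ y ∉ D, V y = 0) {ε : ℝ} (hε : 0 < ε) {a : ℝ} (ha : 0 < a)
    (hgood : ∀ k, a ≤ k → k ∉ badWaveNumbers ε V) :
    ∃ c : ℝ≥0, c < 1 ∧ ∀ k, a ≤ k → ResolventPotentialBound ε k V c := by
  obtain ⟨K, hK⟩ := Filter.eventually_atTop.1
    (eventually_resolventPotentialBound hD hDm hV hV0 hε)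
  obtain ⟨c, hc1, hc⟩ : ∃ c : ℝ≥0, c < 1 ∧ ∀ k ∈ Set.Icc a K, ResolventPotentialBound ε k V c := by
    -- A uniform constant passes to subsets and, through the maximum, to finite unions, so local
    -- existence suffices on the compact interval; beyond `K` the constant `1/2` serves.
    refine isCompact_Icc.induction_on (p := fun s =>
      ∃ c : ℝ≥0, c < 1 ∧ ∀ k ∈ s, ResolventPotentialBound ε k V c) ?_ ?_ ?_ ?_
    · exact ⟨0, one_pos, by simp⟩
    · rintro s t hst ⟨c, hc1, hc⟩
      exact ⟨c, hc1, fun k hk => hc k (hst hk)⟩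
    · rintro s t ⟨c, hc1, hc⟩ ⟨c', hc1', hc'⟩
      refine ⟨max c c', max_lt hc1 hc1', ?_⟩
      rintro k (hk | hk)
      · exact (hc k hk).mono (by simp)
      · exact (hc' k hk).mono (by simp)
    · intro k hk
      obtain ⟨c, hc1, hc⟩ :=
        exists_resolventPotentialBound_of_notMem (ha.trans_le hk.1) (hgood k hk.1)
      obtain ⟨c', hc1', hc'⟩ := exists_eventually_resolventPotentialBound hD hDm hV hV0 hε hc1 hc
      exact ⟨_, mem_nhdsWithin_of_mem_nhds hc', c', hc1', fun l hl => hl⟩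
  refine ⟨max c (1 / 2), max_lt hc1 (by rw [← NNReal.coe_lt_coe]; norm_num), fun k hk => ?_⟩
  rcases le_total k K with h | h
  · exact (hc k ⟨hk, h⟩).mono (by simp)
  · exact (hK k h).mono (by exact_mod_cast le_max_right _ _)

end Potential

/-! ### White noise -/

section Noise

variable {Ω : Type*} [MeasurableSpace Ω] {P : Measure Ω} {D : Set Space}
  {B : (Space → ℝ) → Ω → ℝ}

theorem enorm_sq_eq_ofReal_sq (a : ℝ) : ‖a‖ₑ ^ 2 = ENNReal.ofReal (a ^ 2) := by
  rw [← ofReal_norm, ← ENNReal.ofReal_pow (norm_nonneg _), Real.norm_eq_abs, sq_abs]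

theorem IsWhiteNoise.memLp (hB : IsWhiteNoise P D B) {φ : Space → ℝ}
    (hφ : MemLp φ 2 (volume.restrict D)) : MemLp (B φ) 2 P := by
  have h := hB.gaussian φ hφ
  have h2 : MemLp id 2 (P.map (B φ)) := by
    rw [h.map_eq]
    exact memLp_id_gaussianReal' 2 (by norm_num)
  exact (memLp_map_measure_iff aestronglyMeasurable_id h.aemeasurable).1 h2

theorem lintegral_sub_sq_eq {X : Type*} [MeasurableSpace X] {μ : Measure X} {a b : X → ℝ}
    (ha : MemLp a 2 μ) (hb : MemLp b 2 μ) :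
    ∫⁻ x, ‖a x - b x‖ₑ ^ 2 ∂μ = ENNReal.ofReal
      ((∫ x, a x * a x ∂μ) - 2 * (∫ x, a x * b x ∂μ) + ∫ x, b x * b x ∂μ) := by
  have h2 : Integrable (fun x => (a x - b x) ^ 2) μ := (ha.sub hb).integrable_sq
  simp_rw [enorm_sq_eq_ofReal_sq]
  have haa : Integrable (fun x => a x * a x) μ := ha.integrable_mul ha
  have hab : Integrable (fun x => 2 * (a x * b x)) μ := (ha.integrable_mul hb).const_mul 2
  have hbb : Integrable (fun x => b x * b x) μ := hb.integrable_mul hb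
  have hs : Integrable (fun x => a x * a x - 2 * (a x * b x)) μ := haa.sub hab
  rw [← ofReal_integral_eq_lintegral_ofReal h2 (Filter.Eventually.of_forall fun x => sq_nonneg _),
    ← integral_const_mul, ← integral_sub haa hab, ← integral_add hs hbb]
  congr 1
  refine integral_congr_ae (Filter.Eventually.of_forall fun x => ?_)
  simp only
  ring

/-- Linearity of `φ ↦ B φ` is not assumed: both squares are expanded, and the covariance matches
them term by term. -/
theorem IsWhiteNoise.lintegral_sub_sq (hB : IsWhiteNoise P D B) {φ ψ : Space → ℝ}
    (hφ : MemLp φ 2 (volume.restrict D)) (hψ : MemLp ψ 2 (volume.restrict D)) :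
    ∫⁻ ω, ‖B φ ω - B ψ ω‖ₑ ^ 2 ∂P = ∫⁻ x in D, ‖φ x - ψ x‖ₑ ^ 2 := by
  rw [lintegral_sub_sq_eq (hB.memLp hφ) (hB.memLp hψ), lintegral_sub_sq_eq hφ hψ,
    hB.covariance _ _ hφ hφ, hB.covariance _ _ hφ hψ, hB.covariance _ _ hψ hψ]

theorem IsWhiteNoise.lintegral_sq (hB : IsWhiteNoise P D B) {φ : Space → ℝ}
    (hφ : MemLp φ 2 (volume.restrict D)) :
    ∫⁻ ω, ‖B φ ω‖ₑ ^ 2 ∂P = ∫⁻ x in D, ‖φ x‖ₑ ^ 2 := by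
  simp_rw [enorm_sq_eq_ofReal_sq]
  rw [← ofReal_integral_eq_lintegral_ofReal (hB.memLp hφ).integrable_sq
      (Filter.Eventually.of_forall fun x => by positivity),
    ← ofReal_integral_eq_lintegral_ofReal hφ.integrable_sq
      (Filter.Eventually.of_forall fun x => by positivity)]
  simp_rw [sq]
  rw [hB.covariance _ _ hφ hφ]

theorem IsWhiteNoise.ae_eq_of_ae_eq (hB : IsWhiteNoise P D B) {φ ψ : Space → ℝ}
    (hφ : MemLp φ 2 (volume.restrict D)) (h : φ =ᵐ[volume.restrict D] ψ) : B φ =ᵐ[P] B ψ := by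
  have hψ := hφ.ae_eq h
  have h0 : ∫⁻ ω, ‖B φ ω - B ψ ω‖ₑ ^ 2 ∂P = 0 := by
    rw [hB.lintegral_sub_sq hφ hψ, ← lintegral_zero (μ := volume.restrict D)]
    exact lintegral_congr_ae (h.mono fun x hx => by simp [hx])
  have hm : AEMeasurable (fun ω => ‖B φ ω - B ψ ω‖ₑ ^ 2) P :=
    ((hB.memLp hφ).sub (hB.memLp hψ)).1.enorm.pow_const 2
  exact ((lintegral_eq_zero_iff' hm).1 h0).mono fun ω hω => by simpa [sub_eq_zero] using hω

/-- A measurable family in `L²(D)` is approximated by a countable family, with a measurable choice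
of the approximants. -/
theorem exists_measurable_approximation {F : Space → Space → ℝ}
    (hF : Measurable fun p : Space × Space => F p.1 p.2)
    (hF2 : ∀ x, MemLp (F x) 2 (volume.restrict D)) :
    ∃ (h : ℕ → Space → ℝ) (J : ℕ → Space → ℕ), (∀ j, MemLp (h j) 2 (volume.restrict D)) ∧
      (∀ n, Measurable (J n)) ∧
      ∀ n x, ∫⁻ y in D, ‖h (J n x) y - F x y‖ₑ ^ 2 ≤ (2⁻¹ : ℝ≥0∞) ^ n := by
  classical
  have : Fact ((2 : ℝ≥0∞) ≠ ∞) := ⟨by norm_num⟩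
  obtain ⟨h, hh⟩ : ∃ h : ℕ → Lp ℝ 2 (volume.restrict D : Measure Space), DenseRange h :=
    ⟨_, TopologicalSpace.denseRange_denseSeq _⟩
  have hdm : ∀ j, Measurable fun x => ∫⁻ y in D, ‖h j y - F x y‖ₑ ^ 2 := fun j => by
    have : Measurable fun p : Space × Space => ‖h j p.2 - F p.1 p.2‖ₑ ^ 2 :=
      (((Lp.stronglyMeasurable (h j)).measurable.comp measurable_snd).sub hF).enorm.pow_const 2
    exact this.lintegral_prod_right'
  have hex : ∀ (n : ℕ) (x : Space), ∃ j, ∫⁻ y in D, ‖h j y - F x y‖ₑ ^ 2 < (2⁻¹ : ℝ≥0∞) ^ n := by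
    intro n x
    have hpos : (0 : ℝ≥0∞) < (2⁻¹ : ℝ≥0∞) ^ n := ENNReal.pow_pos (by simp) n
    obtain ⟨j, hj⟩ := hh.exists_mem_open
      (Metric.isOpen_eball (x := (hF2 x).toLp (F x)) (ε := (2⁻¹ : ℝ≥0∞) ^ n))
      ⟨_, Metric.mem_eball_self hpos⟩
    refine ⟨j, ?_⟩
    have hj' : edist (h j) ((hF2 x).toLp (F x)) < (2⁻¹ : ℝ≥0∞) ^ n := hj
    rw [Lp.edist_def, eLpNorm_congr_ae ((Filter.EventuallyEq.refl _ _).sub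
      (hF2 x).coeFn_toLp)] at hj'
    -- Density controls the norm, the claim concerns its square; as the norm is at most `1`,
    -- squaring only decreases it.
    refine lt_of_le_of_lt ?_ hj'
    refine (eLpNorm_two_sq _ (⇑(h j) - F x)).symm.trans_le (pow_le_of_le_one zero_le ?_ two_ne_zero)
    exact hj'.le.trans (pow_le_one₀ zero_le (by simp))
  exact ⟨fun j => h j, fun n x => Nat.find (hex n x), fun j => Lp.memLp (h j), fun n =>
    measurable_find (hex n) fun j => measurableSet_lt (hdm j) measurable_const,
    fun n x => (Nat.find_spec (hex n x)).le⟩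

/-- A measurable family of test functions has a jointly measurable version of the noise. -/
theorem IsWhiteNoise.exists_measurable_version (hB : IsWhiteNoise P D B) {F : Space → Space → ℝ}
    (hF : Measurable fun p : Space × Space => F p.1 p.2)
    (hF2 : ∀ x, MemLp (F x) 2 (volume.restrict D)) :
    ∃ Z : Ω → Space → ℝ, Measurable (Function.uncurry Z) ∧ ∀ x, ∀ᵐ ω ∂P, Z ω x = B (F x) ω := by
  obtain ⟨h, J, hh, hJm, hJ⟩ := exists_measurable_approximation hF hF2
  have hBm : ∀ j, AEMeasurable (B (h j)) P := fun j => (hB.memLp (hh j)).1.aemeasurable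
  choose b hbm hb using hBm
  have hZm : ∀ n, Measurable fun p : Ω × Space => b (J n p.2) p.1 := fun n => by
    have h1 : Measurable fun q : ℕ × Ω => b q.1 q.2 :=
      measurable_from_prod_countable_right hbm
    exact h1.comp (((hJm n).comp measurable_snd).prodMk measurable_fst)
  -- The upper limit is measurable whether or not the sequence converges. For each `x`, the expected
  -- squared errors are at most `2^{-n}`, hence summable, so almost surely it is a true limit.
  refine ⟨fun ω x => Filter.limsup (fun n => b (J n x) ω) Filter.atTop,
    Measurable.limsup hZm, fun x => ?_⟩
  have hdiff : ∀ n, AEMeasurable (fun ω => ‖b (J n x) ω - B (F x) ω‖ₑ ^ 2) P := fun n =>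
    ((hbm _).aemeasurable.sub (hB.memLp (hF2 x)).1.aemeasurable).enorm.pow_const 2
  have hdist : ∀ n, ∫⁻ ω, ‖b (J n x) ω - B (F x) ω‖ₑ ^ 2 ∂P ≤ (2⁻¹ : ℝ≥0∞) ^ n := fun n => by
    have h1 : ∫⁻ ω, ‖b (J n x) ω - B (F x) ω‖ₑ ^ 2 ∂P =
        ∫⁻ ω, ‖B (h (J n x)) ω - B (F x) ω‖ₑ ^ 2 ∂P :=
      lintegral_congr_ae ((hb (J n x)).mono fun ω hω => by simp only [hω])
    rw [h1, hB.lintegral_sub_sq (hh _) (hF2 x)]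
    exact hJ n x
  have hfin : ∫⁻ ω, ∑' n, ‖b (J n x) ω - B (F x) ω‖ₑ ^ 2 ∂P ≠ ∞ := by
    rw [lintegral_tsum hdiff]
    refine ne_top_of_le_ne_top ?_ (ENNReal.tsum_le_tsum hdist)
    rw [ENNReal.tsum_geometric]
    simp
  filter_upwards [ae_lt_top' (AEMeasurable.tsum hdiff) hfin] with ω hω
  have h0 := ENNReal.tendsto_atTop_zero_of_tsum_ne_top hω.ne
  have h1 : Filter.Tendsto (fun n => b (J n x) ω) Filter.atTop (nhds (B (F x) ω)) := by
    rw [tendsto_iff_edist_tendsto_0]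
    have h2 := ((ENNReal.continuous_rpow_const (y := 1 / 2)).tendsto 0).comp h0
    rw [ENNReal.zero_rpow_of_pos (by norm_num)] at h2
    refine h2.congr fun n => ?_
    rw [Function.comp_apply, edist_eq_enorm_sub, ← ENNReal.rpow_natCast, ← ENNReal.rpow_mul]
    norm_num
  exact h1.limsup_eq

theorem ofReal_add_I_mul_ofReal_enorm_sq (a b : ℝ) :
    ‖(a : ℂ) + Complex.I * (b : ℂ)‖ₑ ^ 2 = ‖a‖ₑ ^ 2 + ‖b‖ₑ ^ 2 := by
  rw [enorm_sq_eq_ofReal_sq, enorm_sq_eq_ofReal_sq, ← ENNReal.ofReal_add (sq_nonneg _) (sq_nonneg _),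
    ← ofReal_norm, ← ENNReal.ofReal_pow (norm_nonneg _), ← Complex.normSq_eq_norm_sq,
    mul_comm, Complex.normSq_add_mul_I]

/-- A bounded function has a measurable representative. -/
theorem exists_measurable_representative {g : Space → ℝ} (hg : MemLp g ∞ volume) :
    ∃ (g' : Space → ℝ) (M : ℝ≥0), Measurable g' ∧ g =ᵐ[volume] g' ∧ ∀ᵐ y, ‖g' y‖ₑ ≤ M := by
  refine ⟨hg.1.mk g, (eLpNorm g ∞ volume).toNNReal, hg.1.stronglyMeasurable_mk.measurable,
    hg.1.ae_eq_mk, ?_⟩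
  have h : ∀ᵐ y, ‖g y‖ₑ ≤ eLpNorm g ∞ volume := by
    rw [eLpNorm_exponent_top]
    exact ae_le_eLpNormEssSup
  filter_upwards [hg.1.ae_eq_mk, h] with y h1 h2
  rwa [← h1, ENNReal.coe_toNNReal hg.2.ne]

section

variable {σ : Space → ℝ}

theorem memLp_mul_of_enorm_le (hD : Bornology.IsBounded D) (hDm : MeasurableSet D)
    (hσ : MemLp σ ∞ volume) (k : ℝ) (x : Space) {ψ : Space → ℝ} (hψm : Measurable ψ)
    (hψ : ∀ y, ‖ψ y‖ₑ ≤ ‖fundamentalSolution k x y‖ₑ) :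
    MemLp (fun y => σ y * ψ y) 2 (volume.restrict D) := by
  have h1 : MemLp (fun y => fundamentalSolution k x y) 2 (volume.restrict D) := by
    refine ⟨(measurable_fundamentalSolution k measurable_const
      measurable_id).aestronglyMeasurable, ?_⟩
    have h2 := setLIntegral_fundamentalSolution_lt_top hD hDm k x
    rw [← eLpNorm_two_sq] at h2
    exact (ENNReal.pow_lt_top_iff.1 h2).resolve_right two_ne_zero
  have h2 : MemLp ψ 2 (volume.restrict D) :=
    h1.mono hψm.aestronglyMeasurable (Filter.Eventually.of_forall fun y => by
      have := hψ y
      rwa [← ofReal_norm, ← ofReal_norm, ENNReal.ofReal_le_ofReal_iff (norm_nonneg _)] at this)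
  exact h2.mul (p := ∞) (q := 2) (r := 2) (hσ.restrict D)

theorem enorm_re_le (z : ℂ) : ‖z.re‖ₑ ≤ ‖z‖ₑ := by
  rw [← ofReal_norm, ← ofReal_norm]
  exact ENNReal.ofReal_le_ofReal (Complex.abs_re_le_norm z)

theorem enorm_im_le (z : ℂ) : ‖z.im‖ₑ ≤ ‖z‖ₑ := by
  rw [← ofReal_norm, ← ofReal_norm]
  exact ENNReal.ofReal_le_ofReal (Complex.abs_im_le_norm z)

theorem memLp_mul_re (hD : Bornology.IsBounded D) (hDm : MeasurableSet D)
    (hσ : MemLp σ ∞ volume) (k : ℝ) (x : Space) :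
    MemLp (fun y => σ y * (fundamentalSolution k x y).re) 2 (volume.restrict D) :=
  memLp_mul_of_enorm_le hD hDm hσ k x (by fun_prop) fun y => enorm_re_le _

theorem memLp_mul_im (hD : Bornology.IsBounded D) (hDm : MeasurableSet D)
    (hσ : MemLp σ ∞ volume) (k : ℝ) (x : Space) :
    MemLp (fun y => σ y * (fundamentalSolution k x y).im) 2 (volume.restrict D) :=
  memLp_mul_of_enorm_le hD hDm hσ k x (by fun_prop) fun y => enorm_im_le _

theorem exists_isNoisePotential (hB : IsWhiteNoise P D B) (hD : Bornology.IsBounded D)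
    (hDm : MeasurableSet D) (hσ : MemLp σ ∞ volume) (k : ℝ) :
    ∃ Y : Ω → Space → ℂ, IsNoisePotential P B k σ Y := by
  -- The family of test functions must be jointly measurable, whereas `σ` is only measurable up to a
  -- null set; the isometry makes the substitution harmless.
  obtain ⟨σ', -, hσm, hσe, -⟩ := exists_measurable_representative hσ
  have hσ' : MemLp σ' ∞ volume := hσ.ae_eq hσe
  obtain ⟨Z, hZm, hZ⟩ := hB.exists_measurable_version
    (F := fun x y => σ' y * (fundamentalSolution k x y).re) (by fun_prop)
    (memLp_mul_re hD hDm hσ' k)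
  obtain ⟨W, hWm, hW⟩ := hB.exists_measurable_version
    (F := fun x y => σ' y * (fundamentalSolution k x y).im) (by fun_prop)
    (memLp_mul_im hD hDm hσ' k)
  refine ⟨fun ω x => (Z ω x : ℂ) + Complex.I * (W ω x : ℂ), ?_, fun x => ?_⟩
  · exact (Complex.measurable_ofReal.comp hZm).add
      ((Complex.measurable_ofReal.comp hWm).const_mul Complex.I)
  · filter_upwards [hZ x, hW x,
      hB.ae_eq_of_ae_eq (memLp_mul_re hD hDm hσ k x)
        (ψ := fun y => σ' y * (fundamentalSolution k x y).re)
        ((ae_restrict_of_ae hσe).mono fun y hy => by simp only [hy]),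
      hB.ae_eq_of_ae_eq (memLp_mul_im hD hDm hσ k x)
        (ψ := fun y => σ' y * (fundamentalSolution k x y).im)
        ((ae_restrict_of_ae hσe).mono fun y hy => by simp only [hy])] with ω h1 h2 h3 h4
    rw [noisePairing, h1, h2, h3, h4]

theorem exists_lintegral_noisePairing_sq_le (hB : IsWhiteNoise P D B)
    (hD : Bornology.IsBounded D) (hDm : MeasurableSet D) (hσ : MemLp σ ∞ volume) (k : ℝ) :
    ∃ M : ℝ≥0, ∀ x, ∫⁻ ω, ‖noisePairing B k σ x ω‖ₑ ^ 2 ∂P ≤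
      M * ∫⁻ y in D, ‖fundamentalSolution k x y‖ₑ ^ 2 := by
  obtain ⟨σ', M, -, hσe, hM⟩ := exists_measurable_representative hσ
  -- The real and imaginary parts contribute `M²` each.
  refine ⟨2 * M ^ 2, fun x => ?_⟩
  have hr := memLp_mul_re hD hDm hσ k x
  have hi := memLp_mul_im hD hDm hσ k x
  have hle : ∀ ψ : Space → ℝ, (∀ y, ‖ψ y‖ₑ ≤ ‖fundamentalSolution k x y‖ₑ) →
      ∫⁻ y in D, ‖σ y * ψ y‖ₑ ^ 2 ≤ (M : ℝ≥0∞) ^ 2 *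
        ∫⁻ y in D, ‖fundamentalSolution k x y‖ₑ ^ 2 := fun ψ hψ => by
    rw [← lintegral_const_mul' _ _ (by simp)]
    refine lintegral_mono_ae (ae_restrict_of_ae ?_)
    filter_upwards [hσe, hM] with y h1 h2
    rw [enorm_mul, mul_pow, h1]
    gcongr
    exact hψ y
  simp_rw [noisePairing, ofReal_add_I_mul_ofReal_enorm_sq]
  rw [lintegral_add_left' ((hB.memLp hr).1.enorm.pow_const 2), hB.lintegral_sq hr,
    hB.lintegral_sq hi]
  refine (add_le_add (hle _ fun y => enorm_re_le _) (hle _ fun y => enorm_im_le _)).trans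
    (le_of_eq ?_)
  push_cast
  ring

/-- By Tonelli the expectation of the squared weighted norm is at most a multiple of the squared
Hilbert–Schmidt norm of the kernel; a finite expectation forces almost sure finiteness. -/
theorem IsNoisePotential.ae_memWeightedL2 [SFinite P] (hB : IsWhiteNoise P D B)
    (hD : Bornology.IsBounded D) (hDm : MeasurableSet D) (hσ : MemLp σ ∞ volume) {k : ℝ}
    {Y : Ω → Space → ℂ} (hY : IsNoisePotential P B k σ Y) {ε : ℝ} (hε : 0 < ε) :
    ∀ᵐ ω ∂P, MemWeightedL2 (-(1 / 2) - ε) (Y ω) := by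
  obtain ⟨H, hH⟩ := exists_lintegral_prod_fundamentalSolution_le hD hDm hε
  obtain ⟨M, hM⟩ := exists_lintegral_noisePairing_sq_le hB hD hDm hσ k
  have hYm : Measurable fun p : Ω × Space => ‖Y p.1 p.2‖ₑ ^ 2 := hY.measurable.enorm.pow_const 2
  have hfin : ∫⁻ ω, ∫⁻ x, ‖Y ω x‖ₑ ^ 2 ∂weightedMeasure (-(1 / 2) - ε) ∂P ≠ ∞ := by
    rw [lintegral_lintegral_swap hYm.aemeasurable]
    refine ne_top_of_le_ne_top (b := (M : ℝ≥0∞) * H) (by finiteness) ?_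
    refine le_trans ?_ (mul_le_mul_right (hH k) _)
    rw [lintegral_prod _ (by fun_prop), ← lintegral_const_mul' _ _ ENNReal.coe_ne_top]
    refine lintegral_mono fun x => (le_of_eq ?_).trans (hM x)
    exact lintegral_congr_ae ((hY.version x).mono fun ω hω => by simp only [hω])
  filter_upwards [ae_lt_top hYm.lintegral_prod_right' hfin] with ω hω
  rw [memWeightedL2_iff]
  refine ⟨(hY.measurable.comp measurable_prodMk_left).aestronglyMeasurable, ?_⟩
  rw [← eLpNorm_two_sq] at hω
  exact (ENNReal.pow_lt_top_iff.1 hω).resolve_right two_ne_zero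

end

end Noise

/-! ### The Lippmann–Schwinger equation -/

section LippmannSchwinger

variable {D : Set Space} {V f : Space → ℝ}

theorem measurable_resolvent_realMul {Ω : Type*} [MeasurableSpace Ω] (hV : MemLp V ∞ volume)
    (k : ℝ) {u : Ω → Space → ℂ} (hu : Measurable fun p : Ω × Space => u p.1 p.2) :
    Measurable fun p : Ω × Space => resolvent k (realMul V (u p.1)) p.2 := by
  obtain ⟨V', -, hVm, hVe, -⟩ := exists_measurable_representative hV
  have h : ∀ p : Ω × Space, resolvent k (realMul V (u p.1)) p.2 =
      ∫ y, fundamentalSolution k p.2 y * ((V' y : ℂ) * u p.1 y) := fun p =>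
    integral_congr_ae (hVe.mono fun y hy => by simp only [realMul, hy])
  simp_rw [h]
  have hu' : Measurable fun q : (Ω × Space) × Space => u q.1.1 q.2 :=
    hu.comp ((measurable_fst.comp measurable_fst).prodMk measurable_snd)
  have hV' : Measurable fun q : (Ω × Space) × Space => (V' q.2 : ℂ) := by fun_prop
  have hK : Measurable fun q : (Ω × Space) × Space => fundamentalSolution k q.1.2 q.2 := by
    fun_prop
  exact (hK.mul (hV'.mul hu')).stronglyMeasurable.integral_prod_right'.measurable

theorem measurable_iterate_resolvent_realMul {Ω : Type*} [MeasurableSpace Ω]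
    (hV : MemLp V ∞ volume) (k : ℝ) {g : Ω → Space → ℂ}
    (hg : Measurable fun p : Ω × Space => g p.1 p.2) (n : ℕ) :
    Measurable fun p : Ω × Space => (fun u => resolvent k (realMul V u))^[n] (g p.1) p.2 := by
  induction n with
  | zero => exact hg
  | succ n ih =>
    simp_rw [Function.iterate_succ_apply']
    exact measurable_resolvent_realMul hV k
      (u := fun ω => (fun u => resolvent k (realMul V u))^[n] (g ω)) ih

theorem measurable_planeWave (k : ℝ) (d : Space) : Measurable (planeWave k d) := by
  unfold planeWave
  fun_prop

theorem norm_planeWave (k : ℝ) (d x : Space) : ‖planeWave k d x‖ = 1 := by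
  unfold planeWave
  rw [mul_comm, Complex.norm_exp_ofReal_mul_I]

/-- The weight `-2` is a convenient value below `-3/2`, so that `⟨x⟩^{-4}` is integrable on
three-space. Plane waves need not lie in `L²_{-1/2-ε}`. -/
theorem memWeightedL2_of_norm_le_one {u : Space → ℂ} (hu : Measurable u) (h : ∀ x, ‖u x‖ ≤ 1) :
    MemWeightedL2 (-2) u := by
  rw [memWeightedL2_iff]
  refine ⟨hu.aestronglyMeasurable, ?_⟩
  have h1 : ∫⁻ x, ‖u x‖ₑ ^ 2 ∂weightedMeasure (-2) < ∞ := by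
    have hint := integrable_rpow_neg_one_add_norm_sq (E := Space) (μ := volume) (r := 4)
      (by simp; norm_num)
    have hfin := hint.hasFiniteIntegral
    rw [hasFiniteIntegral_iff_ofReal (Filter.Eventually.of_forall fun x => by positivity)] at hfin
    refine lt_of_le_of_lt ?_ hfin
    rw [lintegral_weightedMeasure]
    refine lintegral_mono fun x => ?_
    have e : bracket x ^ (2 * (-2) : ℝ) = (1 + ‖x‖ ^ 2) ^ (-4 / 2 : ℝ) := by
      unfold bracket
      rw [← Real.rpow_mul (by positivity)]
      norm_num
    rw [e]
    refine mul_le_of_le_one_right zero_le (pow_le_one₀ zero_le ?_)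
    rw [← ofReal_norm]
    exact ENNReal.ofReal_le_one.2 (h x)
  rw [← eLpNorm_two_sq] at h1
  exact (ENNReal.pow_lt_top_iff.1 h1).resolve_right two_ne_zero

theorem memLp_realMul_planeWave (hD : Bornology.IsBounded D) (hDm : MeasurableSet D)
    (hV : MemLp V ∞ volume) (hV0 : ∀ y ∉ D, V y = 0) (k : ℝ) (d : Space) :
    MemLp (realMul V (planeWave k d)) 2 volume :=
  memLp_realMul hD hDm hV hV0
    (memWeightedL2_of_norm_le_one (measurable_planeWave k d) fun x => (norm_planeWave k d x).le)

theorem memLp_ofReal (hD : Bornology.IsBounded D) (hDm : MeasurableSet D)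
    (hf : MemLp f ∞ volume) (hf0 : ∀ y ∉ D, f y = 0) :
    MemLp (fun x => (f x : ℂ)) 2 volume := by
  have h := memLp_realMul hD hDm hf hf0
    (memWeightedL2_of_norm_le_one (u := fun _ => 1) measurable_const (by simp))
  refine h.ae_eq (Filter.Eventually.of_forall fun x => ?_)
  simp only [realMul, mul_one]

theorem memWeightedL2_resolvent (hD : Bornology.IsBounded D) (hDm : MeasurableSet D) {ε : ℝ}
    (hε : 0 < ε) (k : ℝ) {φ : Space → ℂ} (hφ : ∀ y ∉ D, φ y = 0) (hφ2 : MemLp φ 2 volume) :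
    MemWeightedL2 (-(1 / 2) - ε) (resolvent k φ) := by
  obtain ⟨H, hH⟩ := exists_eLpNorm_resolvent_le hD hDm hε
  rw [memWeightedL2_iff]
  refine ⟨(measurable_resolvent k hφ2.1).aestronglyMeasurable, ?_⟩
  rw [← weightedNorm_eq]
  exact (hH k φ hφ hφ2.1).trans_lt (ENNReal.mul_lt_top ENNReal.coe_lt_top hφ2.2)

theorem eLpNorm_le_weightedNorm {s : ℝ} (hs : 0 ≤ s) (φ : Space → ℂ) :
    eLpNorm φ 2 volume ≤ weightedNorm s φ := by
  refine eLpNorm_mono fun x => ?_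
  have h1 : 1 ≤ bracket x ^ s := Real.one_le_rpow (one_le_bracket x) hs
  rw [norm_mul, Complex.norm_real, Real.norm_of_nonneg (zero_le_one.trans h1)]
  exact le_mul_of_one_le_left (norm_nonneg _) h1

/-- The right-hand side of the Lippmann–Schwinger equation for the scattered field. -/
def scatteringData (k α : ℝ) (d : Space) (V f : Space → ℝ) (y : Space → ℂ) (x : Space) : ℂ :=
  (α : ℂ) * resolvent k (realMul V (planeWave k d)) x - resolvent k (fun z => (f z : ℂ)) x - y x

/-- The Neumann series of the Lippmann–Schwinger equation for the scattered field. -/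
def neumannField (k α : ℝ) (d : Space) (V f : Space → ℝ) (y : Space → ℂ) (x : Space) : ℂ :=
  ∑' n, (fun u => resolvent k (realMul V u))^[n] (scatteringData k α d V f y) x

/-- Two weights are allowed because a scattered field and a plane wave, which lie in different
spaces, have to be added. -/
theorem resolvent_realMul_add (hD : Bornology.IsBounded D) (hDm : MeasurableSet D)
    (hV : MemLp V ∞ volume) (hV0 : ∀ y ∉ D, V y = 0) (k : ℝ) {s t : ℝ} {u v : Space → ℂ}
    (hu : MemWeightedL2 s u) (hv : MemWeightedL2 t v) (x : Space) :
    resolvent k (realMul V fun y => u y + v y) x =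
      resolvent k (realMul V u) x + resolvent k (realMul V v) x := by
  rw [← resolvent_add hD hDm k (realMul_eq_zero hV0 u) (memLp_realMul hD hDm hV hV0 hu)
    (realMul_eq_zero hV0 v) (memLp_realMul hD hDm hV hV0 hv)]
  congr 1
  ext y
  simp only [realMul]
  ring

theorem resolvent_realMul_const_mul (k : ℝ) (a : ℂ) (u : Space → ℂ) (x : Space) :
    resolvent k (realMul V fun y => a * u y) x = a * resolvent k (realMul V u) x := by
  rw [← resolvent_const_mul]
  congr 1
  ext y
  simp only [realMul]
  ring

theorem MemWeightedL2.const_mul {s : ℝ} {u : Space → ℂ} (hu : MemWeightedL2 s u) (a : ℂ) :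
    MemWeightedL2 s fun x => a * u x := by
  rw [memWeightedL2_iff] at hu ⊢
  exact hu.const_mul a

theorem memWeightedL2_planeWave (k : ℝ) (d : Space) : MemWeightedL2 (-2) (planeWave k d) :=
  memWeightedL2_of_norm_le_one (measurable_planeWave k d) fun x => (norm_planeWave k d x).le

theorem solvesTotal_add_iff (hD : Bornology.IsBounded D) (hDm : MeasurableSet D)
    (hV : MemLp V ∞ volume) (hV0 : ∀ y ∉ D, V y = 0) {k α s : ℝ} {d : Space} {y v : Space → ℂ}
    (hv : MemWeightedL2 s v) :
    SolvesTotal k α d V f y (fun x => v x + (α : ℂ) * planeWave k d x) ↔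
      SolvesScattered k α d V f y v := by
  unfold SolvesTotal SolvesScattered
  refine Filter.eventually_congr (Filter.Eventually.of_forall fun x => ?_)
  rw [resolvent_realMul_add hD hDm hV hV0 k hv ((memWeightedL2_planeWave k d).const_mul (α : ℂ)),
    resolvent_realMul_const_mul]
  constructor <;> intro h <;> linear_combination h

theorem memWeightedL2_scatteringData (hD : Bornology.IsBounded D) (hDm : MeasurableSet D)
    (hV : MemLp V ∞ volume) (hV0 : ∀ y ∉ D, V y = 0) (hf : MemLp f ∞ volume)
    (hf0 : ∀ y ∉ D, f y = 0) {ε k α : ℝ} (hε : 0 < ε) {d : Space} {y : Space → ℂ}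
    (hy : MemWeightedL2 (-(1 / 2) - ε) y) :
    MemWeightedL2 (-(1 / 2) - ε) (scatteringData k α d V f y) := by
  have h1 := memWeightedL2_resolvent hD hDm hε k (realMul_eq_zero hV0 (planeWave k d))
    (memLp_realMul_planeWave hD hDm hV hV0 k d)
  have h2 := memWeightedL2_resolvent hD hDm hε k (φ := fun z => (f z : ℂ))
    (fun y hy => by simp [hf0 y hy]) (memLp_ofReal hD hDm hf hf0)
  rw [memWeightedL2_iff] at *
  exact ((h1.const_mul (α : ℂ)).sub h2).sub hy

/-- In `max H 1`, the constant `H` serves the two sources in `D`, while the noise term enters with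
factor `1`. -/
theorem weightedNorm_scatteringData_le (hD : Bornology.IsBounded D) (hDm : MeasurableSet D)
    (hV : MemLp V ∞ volume) (hV0 : ∀ y ∉ D, V y = 0) (hf : MemLp f ∞ volume)
    (hf0 : ∀ y ∉ D, f y = 0) {ε k α : ℝ} (hε : 0 < ε) {d : Space} {y : Space → ℂ}
    (hy : MemWeightedL2 (-(1 / 2) - ε) y) {H : ℝ≥0}
    (hH : ∀ (k : ℝ) (φ : Space → ℂ), (∀ y ∉ D, φ y = 0) → AEStronglyMeasurable φ volume →
      weightedNorm (-(1 / 2) - ε) (resolvent k φ) ≤ H * eLpNorm φ 2 volume) :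
    weightedNorm (-(1 / 2) - ε) (scatteringData k α d V f y) ≤ (max H 1 : ℝ≥0) *
      (weightedNorm (1 / 2 + ε) (fun x => (α : ℂ) * realMul V (planeWave k d) x)
        + weightedNorm (1 / 2 + ε) (fun x => (f x : ℂ)) + weightedNorm (-(1 / 2) - ε) y) := by
  have hpm := ((memLp_realMul_planeWave hD hDm hV hV0 k d).const_mul (α : ℂ)).1
  have hfm := (memLp_ofReal hD hDm hf hf0).1
  have h1 := (hH k (fun x => (α : ℂ) * realMul V (planeWave k d) x)
    (fun y hy => by rw [realMul_eq_zero hV0 _ y hy, mul_zero]) hpm).trans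
    (mul_le_mul_right (eLpNorm_le_weightedNorm (s := 1 / 2 + ε) (by positivity) _) _)
  have h2 := (hH k (fun x => (f x : ℂ)) (fun y hy => by simp [hf0 y hy]) hfm).trans
    (mul_le_mul_right (eLpNorm_le_weightedNorm (s := 1 / 2 + ε) (by positivity) _) _)
  have e : scatteringData k α d V f y =
      resolvent k (fun x => (α : ℂ) * realMul V (planeWave k d) x) -
        resolvent k (fun z => (f z : ℂ)) - y := by
    ext x
    simp only [scatteringData, Pi.sub_apply, resolvent_const_mul]
  have hym := ((memWeightedL2_iff _ _).1 hy).1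
  have hm1 := (measurable_resolvent k hpm).aestronglyMeasurable (μ := weightedMeasure (-(1 / 2) - ε))
  have hm2 := (measurable_resolvent k hfm).aestronglyMeasurable (μ := weightedMeasure (-(1 / 2) - ε))
  have h3 : weightedNorm (-(1 / 2) - ε) (scatteringData k α d V f y) ≤
      weightedNorm (-(1 / 2) - ε) (resolvent k fun x => (α : ℂ) * realMul V (planeWave k d) x) +
        weightedNorm (-(1 / 2) - ε) (resolvent k fun z => (f z : ℂ)) +
          weightedNorm (-(1 / 2) - ε) y := by
    rw [e, weightedNorm_eq, weightedNorm_eq, weightedNorm_eq, weightedNorm_eq]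
    refine (eLpNorm_sub_le (hm1.sub hm2) hym (by norm_num)).trans ?_
    gcongr
    exact eLpNorm_sub_le hm1 hm2 (by norm_num)
  have hHm : (H : ℝ≥0∞) ≤ (max H 1 : ℝ≥0) := by exact_mod_cast le_max_left _ _
  have h1m : (1 : ℝ≥0∞) ≤ (max H 1 : ℝ≥0) := by exact_mod_cast le_max_right _ _
  rw [mul_add, mul_add]
  refine h3.trans (add_le_add (add_le_add (h1.trans ?_) (h2.trans ?_)) ?_)
  · gcongr
  · gcongr
  · exact le_mul_of_one_le_left zero_le h1m

theorem neumannField_spec (hD : Bornology.IsBounded D) (hDm : MeasurableSet D)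
    (hV : MemLp V ∞ volume) (hV0 : ∀ y ∉ D, V y = 0) (hf : MemLp f ∞ volume)
    (hf0 : ∀ y ∉ D, f y = 0) {ε k α : ℝ} (hε : 0 < ε) {c : ℝ≥0} (hc1 : c < 1)
    (hc : ResolventPotentialBound ε k V c) {d : Space} {y : Space → ℂ}
    (hy : MemWeightedL2 (-(1 / 2) - ε) y) :
    MemWeightedL2 (-(1 / 2) - ε) (neumannField k α d V f y) ∧
      weightedNorm (-(1 / 2) - ε) (neumannField k α d V f y) ≤
        (1 - c : ℝ≥0∞)⁻¹ * weightedNorm (-(1 / 2) - ε) (scatteringData k α d V f y) ∧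
      SolvesScattered k α d V f y (neumannField k α d V f y) := by
  have hg := memWeightedL2_scatteringData (k := k) (α := α) (d := d) hD hDm hV hV0 hf hf0 hε hy
  rw [memWeightedL2_iff] at hg
  obtain ⟨h1, h2, h3⟩ := neumann_series (μ := weightedMeasure (-(1 / 2) - ε))
    (A := fun u => resolvent k (realMul V u)) hc1
    (fun u hu => (measurable_resolvent k (memLp_realMul hD hDm hV hV0
      ((memWeightedL2_iff _ _).2 hu)).1).aestronglyMeasurable)
    (fun u v hu hv => Filter.Eventually.of_forall fun x => resolvent_realMul_add hD hDm hV hV0 k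
      ((memWeightedL2_iff _ _).2 hu) ((memWeightedL2_iff _ _).2 hv) x)
    (fun u v huv => Filter.Eventually.of_forall fun x => resolvent_congr_ae k
      (((ae_weightedMeasure_iff _).1 huv).mono fun z hz => by simp only [realMul, hz]) x)
    (fun u hu => by
      have := hc u ((memWeightedL2_iff _ _).2 hu)
      rwa [weightedNorm_eq, weightedNorm_eq] at this) hg
  refine ⟨(memWeightedL2_iff _ _).2 h1, ?_, (ae_weightedMeasure_iff _).1 h3⟩
  rw [weightedNorm_eq, weightedNorm_eq]
  exact h2

/-- The difference of two solutions is a fixed point of the contraction `R_k V`. -/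
theorem SolvesScattered.ae_eq (hD : Bornology.IsBounded D) (hDm : MeasurableSet D)
    (hV : MemLp V ∞ volume) (hV0 : ∀ y ∉ D, V y = 0) {ε k α : ℝ} {c : ℝ≥0} (hc1 : c < 1)
    (hc : ResolventPotentialBound ε k V c) {d : Space} {y u v : Space → ℂ}
    (hu : MemWeightedL2 (-(1 / 2) - ε) u) (hv : MemWeightedL2 (-(1 / 2) - ε) v)
    (hus : SolvesScattered k α d V f y u) (hvs : SolvesScattered k α d V f y v) :
    v =ᵐ[volume] u := by
  have hu' := (memWeightedL2_iff _ _).1 hu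
  have hw : MemWeightedL2 (-(1 / 2) - ε) (fun x => v x - u x) := by
    rw [memWeightedL2_iff] at hv ⊢
    exact hv.sub hu'
  have hbound := hc _ hw
  rw [weightedNorm_eq, weightedNorm_eq] at hbound
  have hfix : (fun x => v x - u x) =ᵐ[weightedMeasure (-(1 / 2) - ε)]
      resolvent k (realMul V fun x => v x - u x) := by
    refine (ae_weightedMeasure_iff _).2 ?_
    filter_upwards [hus, hvs] with x h1 h2
    have h3 := resolvent_realMul_add hD hDm hV hV0 k hw hu x
    simp only [sub_add_cancel] at h3
    linear_combination h2 - h1 + h3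
  have h0 := ae_eq_zero_of_contraction hc1 ((memWeightedL2_iff _ _).1 hw) hbound hfix
  filter_upwards [(ae_weightedMeasure_iff _).1 h0] with x hx
  exact sub_eq_zero.1 hx

/-- Solutions of the Lippmann–Schwinger equation lie in `L²_{-1/2-ε'}` as soon as the data do. -/
theorem SolvesScattered.memWeightedL2 (hD : Bornology.IsBounded D) (hDm : MeasurableSet D)
    (hV : MemLp V ∞ volume) (hV0 : ∀ y ∉ D, V y = 0) (hf : MemLp f ∞ volume)
    (hf0 : ∀ y ∉ D, f y = 0) {ε' k α s : ℝ} (hε' : 0 < ε') {d : Space} {y u : Space → ℂ}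
    (hy : MemWeightedL2 (-(1 / 2) - ε') y) (hu : MemWeightedL2 s u)
    (hus : SolvesScattered k α d V f y u) : MemWeightedL2 (-(1 / 2) - ε') u := by
  have h1 := memWeightedL2_scatteringData (k := k) (α := α) (d := d) hD hDm hV hV0 hf hf0 hε' hy
  have h2 := memWeightedL2_resolvent hD hDm hε' k (realMul_eq_zero hV0 u)
    (memLp_realMul hD hDm hV hV0 hu)
  rw [memWeightedL2_iff] at h1 h2 ⊢
  -- The equation reads `u = g + R_k V u`; since `V u` is an `L²` function vanishing off `D`, the
  -- last term lies in every `L²_{-1/2-ε'}`.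
  refine (h1.add h2).ae_eq ((ae_weightedMeasure_iff _).2 ?_)
  filter_upwards [hus] with x hx
  simp only [Pi.add_apply, scatteringData]
  linear_combination -hx

theorem measurable_neumannField {Ω : Type*} [MeasurableSpace Ω] (hD : Bornology.IsBounded D)
    (hDm : MeasurableSet D) (hV : MemLp V ∞ volume) (hV0 : ∀ y ∉ D, V y = 0)
    (hf : MemLp f ∞ volume) (hf0 : ∀ y ∉ D, f y = 0) (k α : ℝ) (d : Space) {Y : Ω → Space → ℂ}
    (hY : Measurable (Function.uncurry Y)) :
    Measurable (Function.uncurry fun ω => neumannField k α d V f (Y ω)) := by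
  refine measurable_tsum_complex fun n => ?_
  refine measurable_iterate_resolvent_realMul hV k (g := fun ω => scatteringData k α d V f (Y ω))
    ?_ n
  have hs : Measurable (Prod.snd : Ω × Space → Space) := measurable_snd
  have h1 := (measurable_resolvent k (memLp_realMul_planeWave hD hDm hV hV0 k d).1).comp hs
  have h2 := (measurable_resolvent k (memLp_ofReal hD hDm hf hf0).1).comp hs
  exact ((h1.const_mul (α : ℂ)).sub h2).sub hY

end LippmannSchwinger

end

end RandomSchrodinger

/-! ### Assembly of the theorem. -/

open RandomSchrodinger
theorem mainTheorem4
    (ε : ℝ) (hε : 0 < ε)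
    (D : Set Space) (hD_open : IsOpen D) (hD_conn : IsConnected D)
    (hD_bdd : Bornology.IsBounded D) (hD_zero : (0 : Space) ∈ D)
    (V : Space → ℝ) (hV : MemLp V ∞ volume) (hVD : tsupport V ⊆ D) :
    -- the supremum in the definition of `k*` is finite
    BddAbove (badWaveNumbers ε V) ∧
    ∃ C : ℝ≥0,
      ∀ k₀ : ℝ, 2 ≤ k₀ → ∀ k : ℝ, kStar k₀ ε V < k →
      ∀ α : ℝ, (α = 0 ∨ α = 1) → ∀ d : Space, ‖d‖ = 1 →
      ∀ f : Space → ℝ, MemLp f ∞ volume → tsupport f ⊆ D →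
      ∀ σ : Space → ℝ, MemLp σ ∞ volume → tsupport σ ⊆ D →
      ∀ (Ω : Type*) [MeasurableSpace Ω] (P : Measure Ω) [IsProbabilityMeasure P]
        (B : (Space → ℝ) → Ω → ℝ), IsWhiteNoise P D B →
      -- the random field `R_k(σ Ḃ)` exists, and for each version `Y` of it:
      (∃ Y : Ω → Space → ℂ, IsNoisePotential P B k σ Y) ∧
      ∀ Y : Ω → Space → ℂ, IsNoisePotential P B k σ Y →
        ∃ usc : Ω → Space → ℂ,
          -- existence
          IsScatteredField P ε k α d V f Y usc ∧
          (∀ ε' : ℝ, 0 < ε' → ∀ᵐ ω ∂P, MemWeightedL2 (-(1 / 2) - ε') (usc ω)) ∧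
          -- uniqueness, realization by realization
          (∀ᵐ ω ∂P, ∀ v : Space → ℂ, MemWeightedL2 (-(1 / 2) - ε) v →
            SolvesScattered k α d V f (Y ω) v → v =ᵐ[volume] usc ω) ∧
          -- a priori bound
          (∀ᵐ ω ∂P, weightedNorm (-(1 / 2) - ε) (usc ω) ≤
            C * (weightedNorm (1 / 2 + ε) (fun x => (α : ℂ) * realMul V (planeWave k d) x)
              + weightedNorm (1 / 2 + ε) (fun x => (f x : ℂ))
              + weightedNorm (-(1 / 2) - ε) (Y ω))) ∧
          -- `usc + α u^i` is the mild solution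
          IsMildSolution P ε k α d V f Y (fun ω x => usc ω x + (α : ℂ) * planeWave k d x) ∧
          (∀ u : Ω → Space → ℂ, IsMildSolution P ε k α d V f Y u →
            ∀ᵐ ω ∂P, u ω =ᵐ[volume] fun x => usc ω x + (α : ℂ) * planeWave k d x) := by
  have hDm : MeasurableSet D := hD_open.measurableSet
  have hV0 := eq_zero_of_notMem hVD
  have hbdd := bddAbove_badWaveNumbers hD_bdd hDm hV hV0 hε
  refine ⟨hbdd, ?_⟩
  -- The half-line starts at the smallest possible `k*`, the one for `k₀ = 2`, so `c` depends on
  -- neither `k₀` nor `k`. The `+ 1` keeps the closed half-line clear of the supremum.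
  obtain ⟨c, hc1, hc⟩ := exists_uniform_resolventPotentialBound hD_bdd hDm hV hV0 hε
    (a := max 2 (sSup (badWaveNumbers ε V) + 1)) (lt_max_of_lt_left two_pos) fun k hk hkb => by
      have h1 := le_csSup hbdd hkb
      have h2 := (le_max_right _ _).trans hk
      linarith
  obtain ⟨H, hH⟩ := exists_eLpNorm_resolvent_le hD_bdd hDm hε
  -- The Neumann series costs `(1 - c)⁻¹`, the data `max H 1`.
  refine ⟨(1 - c)⁻¹ * max H 1, ?_⟩
  intro k₀ hk₀ k hk α _ d _ f hf hfD σ hσ hσD Ω _ P _ B hB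
  have hf0 := eq_zero_of_notMem hfD
  have hkc := hc k (max_le (hk₀.trans ((le_max_left _ _).trans hk.le))
    ((le_max_right _ _).trans hk.le))
  refine ⟨exists_isNoisePotential hB hD_bdd hDm hσ k, fun Y hY => ?_⟩
  have hYmem : ∀ {ε' : ℝ}, 0 < ε' → ∀ᵐ ω ∂P, MemWeightedL2 (-(1 / 2) - ε') (Y ω) := fun hε' =>
    hY.ae_memWeightedL2 hB hD_bdd hDm hσ hε'
  have hspec : ∀ᵐ ω ∂P, _ := (hYmem hε).mono fun ω hω =>
    neumannField_spec (α := α) (d := d) hD_bdd hDm hV hV0 hf hf0 hε hc1 hkc hω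
  have hmeas := measurable_neumannField hD_bdd hDm hV hV0 hf hf0 k α d hY.measurable
  refine ⟨fun ω => neumannField k α d V f (Y ω),
    ⟨hmeas, hspec.mono fun ω h => h.1, hspec.mono fun ω h => h.2.2⟩, ?_, ?_, ?_, ?_, ?_⟩
  · intro ε' hε'
    filter_upwards [hspec, hYmem hε'] with ω h hω
    exact h.2.2.memWeightedL2 hD_bdd hDm hV hV0 hf hf0 hε' hω h.1
  · filter_upwards [hspec] with ω h v hv hvs
    exact h.2.2.ae_eq hD_bdd hDm hV hV0 hc1 hkc h.1 hv hvs
  · filter_upwards [hspec, hYmem hε] with ω h hω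
    refine h.2.1.trans ?_
    rw [ENNReal.coe_mul, ENNReal.coe_inv (tsub_pos_of_lt hc1).ne', ENNReal.coe_sub,
      ENNReal.coe_one, mul_assoc]
    gcongr
    exact weightedNorm_scatteringData_le hD_bdd hDm hV hV0 hf hf0 hε hω hH
  · refine ⟨?_, ?_, ?_⟩
    · exact hmeas.add (((measurable_planeWave k d).comp measurable_snd).const_mul (α : ℂ))
    · filter_upwards [hspec] with ω h
      simpa only [add_sub_cancel_right] using h.1
    · filter_upwards [hspec] with ω h
      exact (solvesTotal_add_iff hD_bdd hDm hV hV0 h.1).2 h.2.2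
  · intro u hu
    filter_upwards [hspec, hu.mem, hu.solves] with ω h hmem hsol
    have hsc : SolvesScattered k α d V f (Y ω) (fun x => u ω x - (α : ℂ) * planeWave k d x) := by
      refine (solvesTotal_add_iff hD_bdd hDm hV hV0 hmem).1 ?_
      simpa only [sub_add_cancel] using hsol
    filter_upwards [h.2.2.ae_eq hD_bdd hDm hV hV0 hc1 hkc h.1 hmem hsc] with x hx
    rw [← hx]
    ring
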